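/- \textbf{Setting.} Let $d,n\ge 0$, let $M\in\mathbb R^{d\times d}$ and $M_z\in\mathbb R^{n\times n}$ be symmetric positive definite, let $V:\mathbb R^d\to\mathbb R$ be $C^1$ and $\xi:\mathbb R^d\to\mathbb R^n$ be $C^2$, and let $\nu,\beta,\delta t>0$. Assume $\int_{\mathbb R^d} e^{-\beta V(q)}\,dq<\infty$. Let $\gamma,\gamma_z$ be symmetric non-negative $d\times d$ and $n\times n$ matrices and let $\sigma,\sigma_z$ be square matrices with $\sigma\sigma^T=\frac2\beta\gamma$, $\sigma_z\sigma_z^T=\frac2\beta\gamma_z$. Write $(\nabla\xi)_{ji}=\partial\xi_i/\partial q_j$ and $$M_\nu(q)=M+\nu^2\,\nabla\xi(q)\,M_z\,\nabla^T\xi(q),\qquad V_{\mathrm{fix},\nu}(q)=\tfrac1{2\beta}\ln\det M_\nu(q),$$ $$H_\nu(p_\nu,q)=\tfrac12p_\nu^TM_\nu(q)^{-1}p_\nu+V(q)+V_{\mathrm{fix},\nu}(q),\qquad \mu_\nu(dp_\nu\,dq)=Z_\nu^{-1}e^{-\beta H_\nu(p_\nu,q)}\,dp_\nu\,dq ,$$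 $$H_{\mathrm{IMMP}}(q,z,p,p^z)=\tfrac12p^TM^{-1}p+\tfrac12(p^z)^TM_z^{-1}p^z+V(q)+V_{\mathrm{fix},\nu}(q).$$ Let $\Sigma$ be the set of all $(q,z,p,p^z)\in\mathbb R^d\times\mathbb R^n\times\mathbb R^d\times\mathbb R^n$ with $\xi(q)=z/\nu$ and $\nabla^T\xi(q)M^{-1}p=\frac1\nu M_z^{-1}p^z$. The map $(q,z,p,p^z)\mapsto(q,p_\nu)$, $p_\nu=M_\nu(q)M^{-1}p$, is a bijection from $\Sigma$ onto $\mathbb R^d\times\mathbb R^d$, through which $\mu_\nu$ is regarded as a measure on $\Sigma$. \textbf{Constrained leapfrog (RATTLE) step.} A point $(q',z',p',p'^z)$ is an outcome of the step from $(q,z,p,p^z)$ if for some $\lambda,\lambda'\in\mathbb R^n$ and some half-step impulses $\bar p,\bar p^z$ $$\bar p=p-\tfrac{\delta t}2\nabla(V+V_{\mathrm{fix},\nu})(q)-\nabla\xi(q)\lambda,\qquad \bar p^z=p^z+\tfrac1\nu\lambda,$$ $$q'=q+\delta t\,M^{-1}\bar p,\qquad z'=z+\delta t\,M_z^{-1}\bar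 p^z,\qquad \xi(q')=\tfrac{z'}\nu,$$ $$p'=\bar p-\tfrac{\delta t}2\nabla(V+V_{\mathrm{fix},\nu})(q')-\nabla\xi(q')\lambda',\qquad p'^z=\bar p^z+\tfrac1\nu\lambda',\qquad \nabla^T\xi(q')M^{-1}p'=\tfrac1\nu M_z^{-1}p'^z .$$ The step is \emph{globally defined} if it has exactly one outcome from every point of $\Sigma$; this outcome then lies in $\Sigma$. \textbf{HMC scheme.} From $x=(q,z,p,p^z)\in\Sigma$: (1) compute the outcome $y$ of the leapfrog step and $\Delta H=H_{\mathrm{IMMP}}(y)-H_{\mathrm{IMMP}}(x)$; (2) move to $y$ with probability $\min(1,e^{-\beta\Delta H})$, and otherwise to $(q,z,-p,-p^z)$; (3) from the point $(q_1,z_1,p_1,p_1^z)$ so obtained, keep $(q_1,z_1)$ and replace $(p_1,p_1^z)$ by the unique $(p_2,p_2^z)$ such that, for some $\lambda\in\mathbb R^n$, $$p_2=p_1-\tfrac{\delta t}2\gamma M^{-1}(p_1+p_2)+\sqrt{\delta t}\,\sigma U-\nabla\xi(q_1)\lambda,\qquad p_2^z=p_1^z-\tfrac{\delta t}2\gamma_zM_z^{-1}(p_1^z+p_2^z)+\sqrt{\delta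 t}\,\sigma_zU_z+\tfrac1\nu\lambda,$$ $$\nabla^T\xi(q_1)M^{-1}p_2=\tfrac1\nu M_z^{-1}p_2^z ,$$ where $U,U_z$ are independent standard Gaussian vectors. The noise used in each iteration (acceptance and Gaussian) is independent of the states produced so far. \textbf{Proposition (Exact sampling).} Assume that the constrained leapfrog step is globally defined. Then $\mu_\nu$ is a probability measure, and its marginal in $q$ is $e^{-\beta V(q)}\,dq\big/\int e^{-\beta V(q)}\,dq$, which does not depend on $\nu$. The law of one step of the HMC scheme defines a Markov kernel $K$ on $\Sigma$ that leaves $\mu_\nu$ invariant. Every sequence $(X_k)_{k\ge0}$ generated by the scheme from a random initial state in $\Sigma$ is a Markov chain with transition kernel $K$, that is, $\mathbb P(X_{k+1}\in A\mid X_0,\dots,X_k)=K(X_k,A)$ almost surely for every $k$ and every measurable $A\subseteq\Sigma$; and if $X_0$ has law $\mu_\nu$, then for every $k$ the state $X_k$ has law $\mu_\nu$ and its position has law $e^{-\beta V(q)}\,dq\big/\int e^{-\beta V(q)}\,dq$. -/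

import Mathlib

open MeasureTheory ProbabilityTheory Matrix

/-- Data of the implicit mass-matrix penalization method: configuration space `ℝ^d`, penalized
degrees of freedom `ξ : ℝ^d → ℝ^n`, potential `V`, mass matrices `M` and `Mz`, penalty intensity
`ν`, inverse temperature `β`, time step `δt`, dissipation matrices `γ`, `γz`, and fluctuation
matrices `σ`, `σz` satisfying the fluctuation-dissipation identities. -/
structure ImmpData (d n : ℕ) where
  M : Matrix (Fin d) (Fin d) ℝ
  Mz : Matrix (Fin n) (Fin n) ℝ
  V : (Fin d → ℝ) → ℝ
  ξ : (Fin d → ℝ) → (Fin n → ℝ)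
  ν : ℝ
  β : ℝ
  δt : ℝ
  γ : Matrix (Fin d) (Fin d) ℝ
  γz : Matrix (Fin n) (Fin n) ℝ
  σ : Matrix (Fin d) (Fin d) ℝ
  σz : Matrix (Fin n) (Fin n) ℝ
  M_posDef : M.PosDef
  Mz_posDef : Mz.PosDef
  V_contDiff : ContDiff ℝ 1 V
  ξ_contDiff : ContDiff ℝ 2 ξ
  ν_pos : 0 < ν
  β_pos : 0 < β
  δt_pos : 0 < δt
  γ_posSemidef : γ.PosSemidef
  γz_posSemidef : γz.PosSemidef
  σ_mul_transpose : σ * σᵀ = (2 / β) • γ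
  σz_mul_transpose : σz * σzᵀ = (2 / β) • γz

/-- Points `(q, z, p, p_z)` of the extended phase space. -/
abbrev ExtPhase (d n : ℕ) : Type :=
  (Fin d → ℝ) × (Fin n → ℝ) × (Fin d → ℝ) × (Fin n → ℝ)

namespace ExtPhase

variable {d n : ℕ}

def q (x : ExtPhase d n) : Fin d → ℝ := x.1

def z (x : ExtPhase d n) : Fin n → ℝ := x.2.1

def p (x : ExtPhase d n) : Fin d → ℝ := x.2.2.1

def pz (x : ExtPhase d n) : Fin n → ℝ := x.2.2.2

/-- Reversal of the impulses. -/
def reverse (x : ExtPhase d n) : ExtPhase d n := (x.q, x.z, -x.p, -x.pz)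

end ExtPhase

namespace ImmpData

noncomputable section

variable {d n : ℕ} (S : ImmpData d n)

/-- The `d × n` matrix `∇ξ(q)`, with entries `(∇ξ)_{ji} = ∂ξ_i/∂q_j`. -/
def gradξ (q : Fin d → ℝ) : Matrix (Fin d) (Fin n) ℝ :=
  Matrix.of fun j i => fderiv ℝ S.ξ q (Pi.single j 1) i

/-- Penalized mass matrix `M_ν(q) = M + ν² ∇ξ M_z ∇ᵀξ`. -/
def penMass (q : Fin d → ℝ) : Matrix (Fin d) (Fin d) ℝ :=
  S.M + S.ν ^ 2 • (S.gradξ q * S.Mz * (S.gradξ q)ᵀ)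

/-- Fixman-type corrector `V_{fix,ν}(q) = (1 / 2β) ln det M_ν(q)`. -/
def fixman (q : Fin d → ℝ) : ℝ := 1 / (2 * S.β) * Real.log (S.penMass q).det

/-- The vector `∇V(q) + ∇V_{fix,ν}(q)`. -/
def gradPot (q : Fin d → ℝ) : Fin d → ℝ :=
  fun j => fderiv ℝ S.V q (Pi.single j 1) + fderiv ℝ S.fixman q (Pi.single j 1)

/-- The mass-penalized Hamiltonian `H_ν(p_ν, q) = ½ p_νᵀ M_ν(q)⁻¹ p_ν + V(q) + V_{fix,ν}(q)`,
at a point `(q, p_ν)`. -/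
def penHamiltonian (y : (Fin d → ℝ) × (Fin d → ℝ)) : ℝ :=
  1 / 2 * (y.2 ⬝ᵥ ((S.penMass y.1)⁻¹ *ᵥ y.2)) + S.V y.1 + S.fixman y.1

/-- Its canonical distribution `Z_ν⁻¹ exp (-β H_ν(p_ν, q)) dp_ν dq` on `ℝ^d × ℝ^d`. -/
def penCanonical : Measure ((Fin d → ℝ) × (Fin d → ℝ)) :=
  (∫⁻ y, ENNReal.ofReal (Real.exp (-S.β * S.penHamiltonian y)))⁻¹ •
    (volume : Measure ((Fin d → ℝ) × (Fin d → ℝ))).withDensity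
      fun y => ENNReal.ofReal (Real.exp (-S.β * S.penHamiltonian y))

/-- The extended Hamiltonian
`H_IMMP = ½ pᵀ M⁻¹ p + ½ p_zᵀ M_z⁻¹ p_z + V(q) + V_{fix,ν}(q)`. -/
def hamiltonian (x : ExtPhase d n) : ℝ :=
  1 / 2 * (x.p ⬝ᵥ (S.M⁻¹ *ᵥ x.p)) + 1 / 2 * (x.pz ⬝ᵥ (S.Mz⁻¹ *ᵥ x.pz)) + S.V x.q + S.fixman x.q

/-- The position constraint `ξ(q) = z / ν`. -/
def PosConstraint (x : ExtPhase d n) : Prop := S.ξ x.q = S.ν⁻¹ • x.z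

/-- The hidden momentum constraint `∇ᵀξ(q) M⁻¹ p = (1/ν) M_z⁻¹ p_z`. -/
def MomConstraint (x : ExtPhase d n) : Prop :=
  (S.gradξ x.q)ᵀ *ᵥ (S.M⁻¹ *ᵥ x.p) = S.ν⁻¹ • (S.Mz⁻¹ *ᵥ x.pz)

/-- The constrained phase space, on which the scheme evolves. -/
abbrev State : Type := {x : ExtPhase d n // S.PosConstraint x ∧ S.MomConstraint x}

/-- One step `x ↦ y` of the constrained leapfrog/Verlet (RATTLE) scheme; `ph`, `pzh` are the
half-step impulses and `l₁`, `l₂` the Lagrange multipliers. -/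
def RattleStep (x y : ExtPhase d n) : Prop :=
  ∃ (l₁ l₂ : Fin n → ℝ) (ph : Fin d → ℝ) (pzh : Fin n → ℝ),
    ph = x.p - (S.δt / 2) • S.gradPot x.q - S.gradξ x.q *ᵥ l₁ ∧
    pzh = x.pz + S.ν⁻¹ • l₁ ∧
    y.q = x.q + S.δt • (S.M⁻¹ *ᵥ ph) ∧
    y.z = x.z + S.δt • (S.Mz⁻¹ *ᵥ pzh) ∧
    S.PosConstraint y ∧
    y.p = ph - (S.δt / 2) • S.gradPot y.q - S.gradξ y.q *ᵥ l₂ ∧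
    y.pz = pzh + S.ν⁻¹ • l₂ ∧
    S.MomConstraint y

/-- The scheme is globally defined: it has exactly one outcome from every state that satisfies
the constraints. -/
def RattleGlobal : Prop := ∀ x : S.State, ∃! y : ExtPhase d n, S.RattleStep x y

variable {S} in
/-- The numerical flow of the constrained leapfrog scheme. -/
def rattleFlow (h : S.RattleGlobal) (x : S.State) : S.State :=
  ⟨(h x).choose, by
    obtain ⟨_, _, _, _, _, _, _, _, h5, _, _, h8⟩ := (h x).choose_spec.1
    exact ⟨h5, h8⟩⟩

/-- Reversal of the impulses on the constrained phase space. -/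
def reverse (x : S.State) : S.State :=
  ⟨x.1.reverse, x.2.1, by
    have h := x.2.2
    simp only [MomConstraint, ExtPhase.reverse, ExtPhase.q, ExtPhase.p, ExtPhase.pz] at h ⊢
    simp only [Matrix.mulVec_neg, smul_neg, h]⟩

/-- One step of the mid-point Euler scheme with constraints for the fluctuation/dissipation part,
driven by the noise `(u, uz)`; `l` is the Lagrange multiplier of the momentum constraint. -/
def FlucDissStep (x : ExtPhase d n) (u : (Fin d → ℝ) × (Fin n → ℝ)) (y : ExtPhase d n) : Prop :=
  y.q = x.q ∧ y.z = x.z ∧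
  (∃ l : Fin n → ℝ,
    y.p = x.p - (S.δt / 2) • (S.γ *ᵥ (S.M⁻¹ *ᵥ (x.p + y.p)))
      + Real.sqrt S.δt • (S.σ *ᵥ u.1) - S.gradξ x.q *ᵥ l ∧
    y.pz = x.pz - (S.δt / 2) • (S.γz *ᵥ (S.Mz⁻¹ *ᵥ (x.pz + y.pz)))
      + Real.sqrt S.δt • (S.σz *ᵥ u.2) + S.ν⁻¹ • l) ∧
  S.MomConstraint y

/-- The linear system behind the constrained mid-point scheme. -/
def flucDissMap (q : Fin d → ℝ) :
    ((Fin d → ℝ) × (Fin n → ℝ) × (Fin n → ℝ)) →ₗ[ℝ] ((Fin d → ℝ) × (Fin n → ℝ) × (Fin n → ℝ)) where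
  toFun w :=
    (w.1 + (S.δt / 2) • (S.γ *ᵥ (S.M⁻¹ *ᵥ w.1)) + S.gradξ q *ᵥ w.2.2,
     w.2.1 + (S.δt / 2) • (S.γz *ᵥ (S.Mz⁻¹ *ᵥ w.2.1)) - S.ν⁻¹ • w.2.2,
     (S.gradξ q)ᵀ *ᵥ (S.M⁻¹ *ᵥ w.1) - S.ν⁻¹ • (S.Mz⁻¹ *ᵥ w.2.1))
  map_add' a b := by
    simp only [Prod.fst_add, Prod.snd_add, Matrix.mulVec_add, smul_add]
    refine Prod.ext ?_ (Prod.ext ?_ ?_) <;> simp only [Prod.fst_add, Prod.snd_add] <;> abel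
  map_smul' c a := by
    refine Prod.ext ?_ (Prod.ext ?_ ?_) <;>
      simp only [Prod.smul_fst, Prod.smul_snd, Matrix.mulVec_smul, smul_add, smul_sub,
        RingHom.id_apply, smul_comm c]

theorem quad_nonneg {m : ℕ} {A : Matrix (Fin m) (Fin m) ℝ} (hA : A.PosSemidef)
    (v : Fin m → ℝ) : 0 ≤ v ⬝ᵥ (A *ᵥ v) := by
  simpa using hA.dotProduct_mulVec_nonneg v

theorem quad_eq_zero {m : ℕ} {A : Matrix (Fin m) (Fin m) ℝ} (hA : A.PosDef)
    {v : Fin m → ℝ} (h : v ⬝ᵥ (A *ᵥ v) ≤ 0) : v = 0 := by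
  by_contra hv
  have := hA.dotProduct_mulVec_pos hv
  simp only [star_trivial] at this
  linarith

theorem flucDissMap_injective (q : Fin d → ℝ) : Function.Injective (S.flucDissMap q) := by
  rw [← LinearMap.ker_eq_bot, LinearMap.ker_eq_bot']
  rintro ⟨a, b, l⟩ h
  have h1 := congrArg Prod.fst h
  have h2 := congrArg (fun w => w.2.1) h
  have h3 := congrArg (fun w => w.2.2) h
  simp only [flucDissMap, LinearMap.coe_mk, AddHom.coe_mk, Prod.fst_zero, Prod.snd_zero] at h1 h2 h3
  have hMi := S.M_posDef.inv
  have hMzi := S.Mz_posDef.inv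
  set v := S.M⁻¹ *ᵥ a with hv
  set w := S.Mz⁻¹ *ᵥ b with hw
  have e1 := congrArg (fun t => v ⬝ᵥ t) h1
  have e2 := congrArg (fun t => w ⬝ᵥ t) h2
  have e3 := congrArg (fun t => l ⬝ᵥ t) h3
  simp only [dotProduct_add, dotProduct_sub, dotProduct_smul, dotProduct_zero, smul_eq_mul]
    at e1 e2 e3
  have e4 : v ⬝ᵥ (S.gradξ q *ᵥ l) = l ⬝ᵥ ((S.gradξ q)ᵀ *ᵥ v) := by
    rw [Matrix.dotProduct_mulVec, dotProduct_comm, Matrix.mulVec_transpose]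
  have e5 : w ⬝ᵥ l = l ⬝ᵥ w := dotProduct_comm _ _
  have e6 : v ⬝ᵥ a = a ⬝ᵥ v := dotProduct_comm _ _
  have e7 : w ⬝ᵥ b = b ⬝ᵥ w := dotProduct_comm _ _
  rw [e5] at e2
  have g1 := mul_nonneg (half_pos S.δt_pos).le (quad_nonneg S.γ_posSemidef v)
  have g2 := mul_nonneg (half_pos S.δt_pos).le (quad_nonneg S.γz_posSemidef w)
  have g3 := quad_nonneg hMi.posSemidef a
  have g4 := quad_nonneg hMzi.posSemidef b
  rw [← hv] at g3
  rw [← hw] at g4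
  have ha : a = 0 := quad_eq_zero hMi (by rw [← hv]; linarith)
  have hb : b = 0 := quad_eq_zero hMzi (by rw [← hw]; linarith)
  have hw0 : w = 0 := by rw [hw, hb, Matrix.mulVec_zero]
  rw [hb, hw0] at h2
  have hl : l = 0 := by
    have : S.ν⁻¹ • l = 0 := by simpa using h2
    exact (smul_eq_zero.1 this).resolve_left (inv_ne_zero S.ν_pos.ne')
  simp [ha, hb, hl]

/-- The constrained mid-point scheme has exactly one outcome. -/
theorem existsUnique_flucDissStep (x : S.State) (u : (Fin d → ℝ) × (Fin n → ℝ)) :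
    ∃! y : ExtPhase d n, S.FlucDissStep x u y := by
  have hinj := S.flucDissMap_injective x.1.q
  have hsurj := LinearMap.injective_iff_surjective.1 hinj
  have key : ∀ (y : ExtPhase d n) (l : Fin n → ℝ),
      ((y.p = x.1.p - (S.δt / 2) • (S.γ *ᵥ (S.M⁻¹ *ᵥ (x.1.p + y.p)))
        + Real.sqrt S.δt • (S.σ *ᵥ u.1) - S.gradξ x.1.q *ᵥ l ∧
      y.pz = x.1.pz - (S.δt / 2) • (S.γz *ᵥ (S.Mz⁻¹ *ᵥ (x.1.pz + y.pz)))
        + Real.sqrt S.δt • (S.σz *ᵥ u.2) + S.ν⁻¹ • l) ∧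
      (S.gradξ x.1.q)ᵀ *ᵥ (S.M⁻¹ *ᵥ y.p) = S.ν⁻¹ • (S.Mz⁻¹ *ᵥ y.pz)) ↔
      S.flucDissMap x.1.q (y.p, y.pz, l) =
        (x.1.p - (S.δt / 2) • (S.γ *ᵥ (S.M⁻¹ *ᵥ x.1.p)) + Real.sqrt S.δt • (S.σ *ᵥ u.1),
         x.1.pz - (S.δt / 2) • (S.γz *ᵥ (S.Mz⁻¹ *ᵥ x.1.pz)) + Real.sqrt S.δt • (S.σz *ᵥ u.2),
         0) := by
    intro y l
    simp only [flucDissMap, LinearMap.coe_mk, AddHom.coe_mk, Prod.mk.injEq, Matrix.mulVec_add,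
      smul_add, and_assoc]
    refine and_congr ?_ (and_congr ?_ ?_)
    · constructor <;> intro h
      · nth_rewrite 1 [h]; abel
      · rw [eq_comm, ← sub_eq_zero] at h
        rw [← sub_eq_zero, ← neg_eq_zero, ← h]; abel
    · constructor <;> intro h
      · nth_rewrite 1 [h]; abel
      · rw [eq_comm, ← sub_eq_zero] at h
        rw [← sub_eq_zero, ← neg_eq_zero, ← h]; abel
    · rw [sub_eq_zero]
  obtain ⟨⟨a, b, l⟩, hw⟩ := hsurj
    (x.1.p - (S.δt / 2) • (S.γ *ᵥ (S.M⁻¹ *ᵥ x.1.p)) + Real.sqrt S.δt • (S.σ *ᵥ u.1),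
     x.1.pz - (S.δt / 2) • (S.γz *ᵥ (S.Mz⁻¹ *ᵥ x.1.pz)) + Real.sqrt S.δt • (S.σz *ᵥ u.2), 0)
  refine ⟨(x.1.q, x.1.z, a, b), ?_, ?_⟩
  · have h := (key (x.1.q, x.1.z, a, b) l).2 hw
    exact ⟨rfl, rfl, ⟨l, h.1⟩, h.2⟩
  · rintro y ⟨hq, hz, ⟨l', hl'⟩, hm⟩
    have hm' := hm
    rw [MomConstraint, hq] at hm'
    have h := (key y l').1 ⟨hl', hm'⟩
    have h' := hinj (h.trans hw.symm)
    simp only [Prod.mk.injEq] at h'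
    exact Prod.ext hq (Prod.ext hz (Prod.ext h'.1 h'.2.1))

/-- The outcome of the fluctuation/dissipation step driven by the noise `u`. -/
def flucDiss (x : S.State) (u : (Fin d → ℝ) × (Fin n → ℝ)) : S.State :=
  ⟨(S.existsUnique_flucDissStep x u).choose, by
    obtain ⟨h1, h2, _, h4⟩ := (S.existsUnique_flucDissStep x u).choose_spec.1
    refine ⟨?_, h4⟩
    have h := x.2.1
    unfold PosConstraint at h ⊢
    rw [h1, h2]
    exact h⟩

/-- Law of the noise `(w, u, uz)` of one step: `w` uniform on `[0, 1]` and `u`, `uz` standard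
Gaussian vectors of `ℝ^d` and `ℝ^n`, all independent. -/
def noiseLaw (d n : ℕ) : Measure (ℝ × (Fin d → ℝ) × (Fin n → ℝ)) :=
  (volume.restrict (Set.Icc (0 : ℝ) 1)).prod
    ((Measure.pi fun _ => gaussianReal 0 1).prod (Measure.pi fun _ => gaussianReal 0 1))

variable {S} in
/-- One step of the Hybrid Monte Carlo scheme: propose the outcome `y` of the constrained leapfrog
step, accept it with probability `min (1, exp (-β ΔH))` and otherwise reverse the impulses of `x`,
and then apply the fluctuation/dissipation step. -/
def hmcStep (h : S.RattleGlobal) (x : S.State) (w : ℝ × (Fin d → ℝ) × (Fin n → ℝ)) : S.State :=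
  let y := rattleFlow h x
  let ΔH := S.hamiltonian y - S.hamiltonian x
  S.flucDiss (if w.1 ≤ min 1 (Real.exp (-S.β * ΔH)) then y else S.reverse x) w.2

/-- The coordinates `(q, p_ν)` of a state, where `p_ν = M_ν(q) M⁻¹ p`. -/
def toPhase (x : S.State) : (Fin d → ℝ) × (Fin d → ℝ) :=
  (x.1.q, S.penMass x.1.q *ᵥ (S.M⁻¹ *ᵥ x.1.p))

/-- The state with coordinates `(q, p_ν)`: `z = ν ξ(q)`, `p = M M_ν(q)⁻¹ p_ν` and
`p_z = ν M_z ∇ᵀξ(q) M_ν(q)⁻¹ p_ν`. -/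
def ofPhase (y : (Fin d → ℝ) × (Fin d → ℝ)) : S.State :=
  ⟨(y.1, S.ν • S.ξ y.1, S.M *ᵥ ((S.penMass y.1)⁻¹ *ᵥ y.2),
    S.ν • (S.Mz *ᵥ ((S.gradξ y.1)ᵀ *ᵥ ((S.penMass y.1)⁻¹ *ᵥ y.2)))), by
    have hM : IsUnit S.M.det := (Matrix.isUnit_iff_isUnit_det _).1 S.M_posDef.isUnit
    have hMz : IsUnit S.Mz.det := (Matrix.isUnit_iff_isUnit_det _).1 S.Mz_posDef.isUnit
    constructor
    · simp only [PosConstraint, ExtPhase.q, ExtPhase.z]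
      rw [smul_smul, inv_mul_cancel₀ S.ν_pos.ne', one_smul]
    · simp only [MomConstraint, ExtPhase.q, ExtPhase.p, ExtPhase.pz]
      rw [Matrix.mulVec_smul, smul_smul, inv_mul_cancel₀ S.ν_pos.ne', one_smul,
        Matrix.mulVec_mulVec _ S.M⁻¹ S.M, Matrix.nonsing_inv_mul _ hM, Matrix.one_mulVec,
        Matrix.mulVec_mulVec _ S.Mz⁻¹ S.Mz, Matrix.nonsing_inv_mul _ hMz, Matrix.one_mulVec]⟩

theorem penMass_posDef (q : Fin d → ℝ) : (S.penMass q).PosDef := by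
  refine S.M_posDef.add_posSemidef ?_
  have h := S.Mz_posDef.posSemidef.mul_mul_conjTranspose_same (S.gradξ q)
  rw [Matrix.conjTranspose_eq_transpose_of_trivial] at h
  exact h.smul (sq_nonneg S.ν)

theorem toPhase_ofPhase (y : (Fin d → ℝ) × (Fin d → ℝ)) : S.toPhase (S.ofPhase y) = y := by
  have hM : IsUnit S.M.det := (Matrix.isUnit_iff_isUnit_det _).1 S.M_posDef.isUnit
  have hP : IsUnit (S.penMass y.1).det :=
    (Matrix.isUnit_iff_isUnit_det _).1 (S.penMass_posDef y.1).isUnit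
  refine Prod.ext rfl ?_
  simp only [toPhase, ofPhase, ExtPhase.q, ExtPhase.p]
  rw [Matrix.mulVec_mulVec _ S.M⁻¹ S.M, Matrix.nonsing_inv_mul _ hM, Matrix.one_mulVec,
    Matrix.mulVec_mulVec, Matrix.mul_nonsing_inv _ hP, Matrix.one_mulVec]

theorem ofPhase_toPhase (x : S.State) : S.ofPhase (S.toPhase x) = x := by
  have hM : IsUnit S.M.det := (Matrix.isUnit_iff_isUnit_det _).1 S.M_posDef.isUnit
  have hMz : IsUnit S.Mz.det := (Matrix.isUnit_iff_isUnit_det _).1 S.Mz_posDef.isUnit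
  have hP : IsUnit (S.penMass x.1.q).det :=
    (Matrix.isUnit_iff_isUnit_det _).1 (S.penMass_posDef x.1.q).isUnit
  have hν := S.ν_pos.ne'
  have h1 : S.ξ x.1.q = S.ν⁻¹ • x.1.z := x.2.1
  have h2 : (S.gradξ x.1.q)ᵀ *ᵥ (S.M⁻¹ *ᵥ x.1.p) = S.ν⁻¹ • (S.Mz⁻¹ *ᵥ x.1.pz) := x.2.2
  have h3 : (S.penMass x.1.q)⁻¹ *ᵥ (S.penMass x.1.q *ᵥ (S.M⁻¹ *ᵥ x.1.p)) = S.M⁻¹ *ᵥ x.1.p := by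
    rw [Matrix.mulVec_mulVec, Matrix.nonsing_inv_mul _ hP, Matrix.one_mulVec]
  apply Subtype.ext
  refine Prod.ext rfl (Prod.ext ?_ (Prod.ext ?_ ?_))
  · change S.ν • S.ξ x.1.q = x.1.z
    rw [h1, smul_smul, mul_inv_cancel₀ hν, one_smul]
  · change S.M *ᵥ ((S.penMass x.1.q)⁻¹ *ᵥ (S.penMass x.1.q *ᵥ (S.M⁻¹ *ᵥ x.1.p))) = x.1.p
    rw [h3, Matrix.mulVec_mulVec, Matrix.mul_nonsing_inv _ hM, Matrix.one_mulVec]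
  · change S.ν • (S.Mz *ᵥ ((S.gradξ x.1.q)ᵀ *ᵥ ((S.penMass x.1.q)⁻¹ *ᵥ
      (S.penMass x.1.q *ᵥ (S.M⁻¹ *ᵥ x.1.p))))) = x.1.pz
    rw [h3, h2, Matrix.mulVec_smul, smul_smul, mul_inv_cancel₀ hν, one_smul,
      Matrix.mulVec_mulVec, Matrix.mul_nonsing_inv _ hMz, Matrix.one_mulVec]

/-- The mass-penalized canonical distribution, read on the constrained phase space through the
bijection `(q, p_ν) ↦ (q, z, p, p_z)`. -/
def stateCanonical : Measure S.State := S.penCanonical.map S.ofPhase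

/-- `X` is generated by the Hybrid Monte Carlo scheme on the probability space `(Ω, P)`: the
random initial state is arbitrary, and `X (k+1)` is obtained from `X k` by one step of the scheme
whose noise `ζ k` has the law `noiseLaw` and is independent of `(X 0, …, X k)`. -/
structure IsHMCSequence (h : S.RattleGlobal) {Ω : Type*} [MeasurableSpace Ω] (P : Measure Ω)
    (X : ℕ → Ω → S.State) : Prop where
  measurable_zero : Measurable (X 0)
  exists_noise : ∃ ζ : ℕ → Ω → ℝ × (Fin d → ℝ) × (Fin n → ℝ),
    (∀ k, Measurable (ζ k)) ∧ (∀ k, P.map (ζ k) = noiseLaw d n) ∧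
    (∀ k, IndepFun (fun ω (j : Fin (k + 1)) => X j ω) (ζ k) P) ∧
    ∀ k ω, X (k + 1) ω = hmcStep h (X k ω) (ζ k ω)

end

end ImmpData

/-- The original canonical distribution in the position variables,
`exp (-β V(q)) dq / ∫ exp (-β V(q)) dq`. -/
noncomputable def positionCanonical {d : ℕ} (β : ℝ) (V : (Fin d → ℝ) → ℝ) : Measure (Fin d → ℝ) :=
  (∫⁻ q, ENNReal.ofReal (Real.exp (-β * V q)))⁻¹ •
    (volume : Measure (Fin d → ℝ)).withDensity fun q => ENNReal.ofReal (Real.exp (-β * V q))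

/-! In the coordinates (q, p_ν) the multipliers disappear. On the constraint set p_ν = p +
ν∇ξ(q)p_z, and a multiplier changes (p, p_z) by (-∇ξ λ, λ/ν), which leaves p_ν unchanged. The energy
`hamiltonian` becomes `penHamiltonian`. For fixed q the Gibbs density is Gaussian in p_ν with
covariance M_ν/β. Its mass contains √det M_ν, which exp(-βV_fix) cancels, so the fibre mass is the
same at every q and the position marginal is exp(-βV) (`lintegral_gibbs_fibre`).

A leapfrog step from q to q' reads p_ν = G(q,q'), p'_ν = -G(q',q) (`rattleStep_iff`). Here G = -∂_q
of the discrete Lagrangian (1/2δt)(|q'-q|²_M + ν²|ξ(q')-ξ(q)|²_{M_z}) - (δt/2)(U(q)+U(q')), where U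
= V + V_fix. With F(q,q') = (q, G(q,q')) and N the momentum reversal, the flow is N∘F∘swap∘F⁻¹, and
global definedness is what makes F bijective. Exchanging q and q' transposes ∂G/∂q', so the
determinants agree and the flow preserves dq dp_ν (`lintegral_comp_rattleFlow`). The same formula
gives reversibility. Volume preservation and reversibility are what the Metropolis argument needs
(`lintegral_metropolis`).

The fluctuation/dissipation step is, at fixed q, an unconstrained mid-point scheme with mass M_ν and
friction γ_ν = γ + ν²∇ξγ_z∇ᵀξ (`toPhase_flucDiss`). An exact matrix identity shows that it preserves
the Gaussian of covariance M_ν/β for every δt (`lintegral_midUpdate`).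

Composing the two gives invariance. The Markov property follows because independent noise makes the
joint law of the history and the next state a composition-product with the kernel
(`map_hmcStep_eq_compProd`). -/

/-! ### Gaussian vectors and linear changes of variables. -/

/-- The standard Gaussian measure on `ℝ^m`. -/
noncomputable abbrev stdGaussianPi (m : ℕ) : Measure (Fin m → ℝ) :=
  Measure.pi fun _ => gaussianReal 0 1

/-- A product measure is determined by its values on boxes, and there the integral of the product
density factorizes. -/
theorem stdGaussianPi_eq_withDensity (m : ℕ) :
    stdGaussianPi m = volume.withDensity
      fun w => ENNReal.ofReal (∏ i, gaussianPDFReal 0 1 (w i)) := by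
  symm
  refine (Measure.pi_eq fun s hs => ?_).symm
  have hint : ∀ i, Integrable (gaussianPDFReal 0 1) ((volume : Measure ℝ).restrict (s i)) :=
    fun i => (integrable_gaussianPDFReal 0 1).restrict
  rw [withDensity_apply _ (MeasurableSet.univ_pi hs), volume_pi, Measure.restrict_pi_pi,
    ← ofReal_integral_eq_lintegral_ofReal (Integrable.fintype_prod hint)
      (Filter.Eventually.of_forall fun w =>
        Finset.prod_nonneg fun i _ => gaussianPDFReal_nonneg 0 1 (w i)),
    integral_fintype_prod_eq_prod,
    ENNReal.ofReal_prod_of_nonneg fun i _ =>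
      integral_nonneg fun x => gaussianPDFReal_nonneg 0 1 x]
  exact Finset.prod_congr rfl fun i _ =>
    (gaussianReal_apply_eq_integral 0 one_ne_zero (s i)).symm

theorem prod_gaussianPDFReal {m : ℕ} (w : Fin m → ℝ) :
    ∏ i, gaussianPDFReal 0 1 (w i)
      = (Real.sqrt (2 * Real.pi))⁻¹ ^ m * Real.exp (-(1 / 2 * (w ⬝ᵥ w))) := by
  simp only [gaussianPDFReal, Finset.prod_mul_distrib, Finset.prod_const, Finset.card_univ,
    Fintype.card_fin, ← Real.exp_sum, dotProduct, Finset.mul_sum, ← Finset.sum_neg_distrib]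
  simp only [NNReal.coe_one, mul_one, sub_zero]
  congr 2
  exact Finset.sum_congr rfl fun i _ => by ring

theorem lintegral_exp_mul {m : ℕ} {g : (Fin m → ℝ) → ENNReal} (hg : Measurable g) :
    ∫⁻ w, ENNReal.ofReal (Real.exp (-(1 / 2 * (w ⬝ᵥ w)))) * g w
      = ENNReal.ofReal (Real.sqrt (2 * Real.pi) ^ m) * ∫⁻ w, g w ∂stdGaussianPi m := by
  have hd : Measurable fun w : Fin m → ℝ =>
      ENNReal.ofReal (∏ i, gaussianPDFReal 0 1 (w i)) :=
    (Finset.measurable_prod _ fun i _ =>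
      (measurable_gaussianPDFReal 0 1).comp (measurable_pi_apply i)).ennreal_ofReal
  rw [stdGaussianPi_eq_withDensity, lintegral_withDensity_eq_lintegral_mul _ hd hg,
    ← lintegral_const_mul _ (hd.mul hg)]
  refine lintegral_congr fun w => ?_
  have hs : 0 < Real.sqrt (2 * Real.pi) := by positivity
  rw [Pi.mul_apply, ← mul_assoc, ← ENNReal.ofReal_mul (by positivity), prod_gaussianPDFReal,
    ← mul_assoc, ← mul_pow, mul_inv_cancel₀ hs.ne', one_pow, one_mul]

theorem lintegral_eq_det_mul_lintegral_mulVec {m : ℕ} {L : Matrix (Fin m) (Fin m) ℝ}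
    (hL : L.det ≠ 0) {g : (Fin m → ℝ) → ENNReal} (hg : Measurable g) :
    ∫⁻ p, g p = ENNReal.ofReal |L.det| * ∫⁻ w, g (L *ᵥ w) := by
  have h := congrArg (fun μ => ∫⁻ p, g p ∂μ) (Real.map_matrix_volume_pi_eq_smul_volume_pi hL)
  rw [lintegral_map hg (by fun_prop), lintegral_smul_measure] at h
  simp only [Matrix.toLin'_apply, smul_eq_mul] at h
  rw [h, ← mul_assoc, ← ENNReal.ofReal_mul (abs_nonneg _), ← abs_mul, mul_inv_cancel₀ hL, abs_one,
    ENNReal.ofReal_one, one_mul]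

/-- The characteristic function of a product measure factorizes, and on the i-th axis `ℓ` is
multiplication by `a i`. -/
theorem charFunDual_stdGaussianPi {m : ℕ} (a : Fin m → ℝ) (ℓ : StrongDual ℝ (Fin m → ℝ))
    (h : ∀ w, ℓ w = a ⬝ᵥ w) :
    charFunDual (stdGaussianPi m) ℓ = Complex.exp (-((a ⬝ᵥ a : ℝ) : ℂ) / 2) := by
  rw [charFunDual_pi]
  have : ∀ i, charFunDual (gaussianReal 0 1)
      (ℓ.comp (ContinuousLinearMap.single ℝ (fun _ => ℝ) i)) = Complex.exp (-((a i * a i : ℝ) : ℂ) / 2) := by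
    intro i
    rw [charFunDual_eq_charFun_map_one]
    have : (⇑(ℓ.comp (ContinuousLinearMap.single ℝ (fun _ => ℝ) i))) = fun x => a i * x := by
      ext x
      simp [h]
    rw [this, gaussianReal_map_const_mul, charFun_gaussianReal]
    simp
    ring_nf
  simp only [this, ← Complex.exp_sum]
  congr 1
  simp only [dotProduct, Complex.ofReal_sum]
  rw [← Finset.sum_neg_distrib, Finset.sum_div]

/-- Linear images of independent standard Gaussian vectors with equal covariances have the same
law. -/
theorem map_stdGaussianPi_eq_of_covariance {m a b c : ℕ} (L : Matrix (Fin m) (Fin m) ℝ)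
    (A : Matrix (Fin m) (Fin a) ℝ) (B : Matrix (Fin m) (Fin b) ℝ) (C : Matrix (Fin m) (Fin c) ℝ)
    (h : A * Aᵀ + B * Bᵀ + C * Cᵀ = L * Lᵀ) :
    ((stdGaussianPi a).prod ((stdGaussianPi b).prod (stdGaussianPi c))).map
        (fun w => A *ᵥ w.1 + B *ᵥ w.2.1 + C *ᵥ w.2.2)
      = (stdGaussianPi m).map (fun w => L *ᵥ w) := by
  have key : ∀ {k : ℕ} (D : Matrix (Fin m) (Fin k) ℝ) (v : Fin m → ℝ),
      (Dᵀ *ᵥ v) ⬝ᵥ (Dᵀ *ᵥ v) = v ⬝ᵥ ((D * Dᵀ) *ᵥ v) := by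
    intro k D v
    rw [← Matrix.mulVec_mulVec, Matrix.dotProduct_mulVec v, Matrix.mulVec_transpose]
  let T : ((Fin a → ℝ) × (Fin b → ℝ) × (Fin c → ℝ)) →L[ℝ] (Fin m → ℝ) :=
    (Matrix.toLin' A).toContinuousLinearMap ∘L ContinuousLinearMap.fst ℝ _ _
    + (Matrix.toLin' B).toContinuousLinearMap ∘L ContinuousLinearMap.fst ℝ _ _
        ∘L ContinuousLinearMap.snd ℝ _ _
    + (Matrix.toLin' C).toContinuousLinearMap ∘L ContinuousLinearMap.snd ℝ _ _
        ∘L ContinuousLinearMap.snd ℝ _ _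
  have hT : (fun w : (Fin a → ℝ) × (Fin b → ℝ) × (Fin c → ℝ) =>
      A *ᵥ w.1 + B *ᵥ w.2.1 + C *ᵥ w.2.2) = T := by
    ext w; simp [T]
  have hL : (fun w => L *ᵥ w) = (Matrix.toLin' L).toContinuousLinearMap := by
    ext w; simp
  have hTm : Measurable T := T.continuous.measurable
  have hLm : Measurable (Matrix.toLin' L).toContinuousLinearMap :=
    (Matrix.toLin' L).toContinuousLinearMap.continuous.measurable
  rw [hT, hL]
  have := Measure.isProbabilityMeasure_map hTm.aemeasurable
    (μ := (stdGaussianPi a).prod ((stdGaussianPi b).prod (stdGaussianPi c)))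
  have := Measure.isProbabilityMeasure_map hLm.aemeasurable (μ := stdGaussianPi m)
  -- Both laws are centred Gaussian, so their characteristic functions at `ℓ` depend only on the
  -- covariance form at the vector representing `ℓ`.
  refine Measure.ext_of_charFunDual (funext fun ℓ => ?_)
  obtain ⟨v, hv⟩ : ∃ v : Fin m → ℝ, ∀ w, ℓ w = v ⬝ᵥ w := by
    refine ⟨fun i => ℓ (Pi.single i 1), fun w => ?_⟩
    conv_lhs => rw [← Finset.univ_sum_single w]
    simp only [map_sum, dotProduct]
    refine Finset.sum_congr rfl fun i _ => ?_
    have : Pi.single i (w i) = w i • (Pi.single i 1 : Fin m → ℝ) := by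
      rw [← Pi.single_smul, smul_eq_mul, mul_one]
    rw [this, map_smul, smul_eq_mul, mul_comm]
  have hD : ∀ {k : ℕ} (D : Matrix (Fin m) (Fin k) ℝ) (w : Fin k → ℝ),
      ℓ (D *ᵥ w) = (Dᵀ *ᵥ v) ⬝ᵥ w := by
    intro k D w
    rw [hv, Matrix.dotProduct_mulVec, Matrix.mulVec_transpose]
  rw [charFunDual_map, charFunDual_map, charFunDual_prod, charFunDual_prod,
    charFunDual_stdGaussianPi (Aᵀ *ᵥ v) _ fun w => by simp [T, hD],
    charFunDual_stdGaussianPi (Bᵀ *ᵥ v) _ fun w => by simp [T, hD],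
    charFunDual_stdGaussianPi (Cᵀ *ᵥ v) _ fun w => by simp [T, hD],
    charFunDual_stdGaussianPi (Lᵀ *ᵥ v) _ fun w => by simp [hD],
    ← Complex.exp_add, ← Complex.exp_add]
  congr 1
  rw [key, key, key, key, ← h, Matrix.add_mulVec, Matrix.add_mulVec, dotProduct_add,
    dotProduct_add]
  push_cast
  ring

/-! ### The coordinates (q, p_ν) on the constrained phase space. -/

namespace ImmpData

variable {d n : ℕ} (S : ImmpData d n)

theorem isUnit_det_M : IsUnit S.M.det := (Matrix.isUnit_iff_isUnit_det _).1 S.M_posDef.isUnit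

theorem isUnit_det_Mz : IsUnit S.Mz.det := (Matrix.isUnit_iff_isUnit_det _).1 S.Mz_posDef.isUnit

theorem isUnit_det_penMass (q : Fin d → ℝ) : IsUnit (S.penMass q).det :=
  (Matrix.isUnit_iff_isUnit_det _).1 (S.penMass_posDef q).isUnit

theorem transpose_M : S.Mᵀ = S.M := by
  simpa [Matrix.conjTranspose_eq_transpose_of_trivial] using S.M_posDef.isHermitian.eq

theorem transpose_Mz : S.Mzᵀ = S.Mz := by
  simpa [Matrix.conjTranspose_eq_transpose_of_trivial] using S.Mz_posDef.isHermitian.eq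

theorem transpose_penMass (q : Fin d → ℝ) : (S.penMass q)ᵀ = S.penMass q := by
  simpa [Matrix.conjTranspose_eq_transpose_of_trivial] using (S.penMass_posDef q).isHermitian.eq

theorem continuous_gradξ : Continuous S.gradξ := by
  refine continuous_matrix fun j i => ?_
  have h := S.ξ_contDiff.continuous_fderiv (by norm_num)
  exact (continuous_apply i).comp (h.clm_apply continuous_const)

theorem continuous_penMass : Continuous S.penMass := by
  have h := S.continuous_gradξ
  unfold penMass
  fun_prop

theorem continuous_penMass_inv : Continuous fun q => (S.penMass q)⁻¹ := by
  simp only [Matrix.inv_def, Ring.inverse_eq_inv']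
  exact (S.continuous_penMass.matrix_det.inv₀ fun q => (S.isUnit_det_penMass q).ne_zero).smul
    S.continuous_penMass.matrix_adjugate

theorem continuous_fixman : Continuous S.fixman :=
  continuous_const.mul
    (S.continuous_penMass.matrix_det.log fun q => (S.isUnit_det_penMass q).ne_zero)

theorem continuous_penHamiltonian : Continuous S.penHamiltonian := by
  have h1 := S.continuous_penMass_inv.comp
    (continuous_fst : Continuous (Prod.fst : (Fin d → ℝ) × (Fin d → ℝ) → _))
  have h2 := S.V_contDiff.continuous
  have h3 := S.continuous_fixman
  have h4 : Continuous fun y : (Fin d → ℝ) × (Fin d → ℝ) => y.2 ⬝ᵥ ((S.penMass y.1)⁻¹ *ᵥ y.2) :=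
    continuous_snd.dotProduct (h1.matrix_mulVec continuous_snd)
  unfold penHamiltonian
  fun_prop

/-- Derivatives are measurable without any smoothness, so differentiability of V_fix need not be
established. -/
theorem measurable_gradPot : Measurable S.gradPot :=
  measurable_pi_lambda _ fun j =>
    (measurable_fderiv_apply_const ℝ S.V (Pi.single j 1)).add
      (measurable_fderiv_apply_const ℝ S.fixman (Pi.single j 1))

theorem continuous_toPhase : Continuous S.toPhase := by
  have hq : Continuous fun x : S.State => x.1.q := continuous_fst.comp continuous_subtype_val
  have hp : Continuous fun x : S.State => x.1.p :=
    (continuous_fst.comp (continuous_snd.comp continuous_snd)).comp continuous_subtype_val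
  exact hq.prodMk ((S.continuous_penMass.comp hq).matrix_mulVec
    (continuous_const.matrix_mulVec hp))

theorem continuous_ofPhase : Continuous S.ofPhase := by
  have h0 : Continuous fun y : (Fin d → ℝ) × (Fin d → ℝ) => (S.penMass y.1)⁻¹ *ᵥ y.2 :=
    (S.continuous_penMass_inv.comp continuous_fst).matrix_mulVec continuous_snd
  have h1 : Continuous fun y : (Fin d → ℝ) × (Fin d → ℝ) => (S.gradξ y.1)ᵀ :=
    (S.continuous_gradξ.comp continuous_fst).matrix_transpose
  have h2 : Continuous fun y : (Fin d → ℝ) × (Fin d → ℝ) => S.ξ y.1 :=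
    S.ξ_contDiff.continuous.comp continuous_fst
  have h3 := (continuous_const (y := S.M)).matrix_mulVec h0
  have h4 := (continuous_const (y := S.Mz)).matrix_mulVec (h1.matrix_mulVec h0)
  exact Continuous.subtype_mk
    (continuous_fst.prodMk ((h2.const_smul S.ν).prodMk (h3.prodMk (h4.const_smul S.ν)))) _

/-- The constrained phase space is homeomorphic to the phase space of `(q, p_ν)`. -/
noncomputable def phaseHomeomorph : S.State ≃ₜ (Fin d → ℝ) × (Fin d → ℝ) where
  toFun := S.toPhase
  invFun := S.ofPhase
  left_inv := S.ofPhase_toPhase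
  right_inv := S.toPhase_ofPhase
  continuous_toFun := S.continuous_toPhase
  continuous_invFun := S.continuous_ofPhase

theorem measurable_toPhase : Measurable S.toPhase := S.continuous_toPhase.measurable

theorem measurable_ofPhase : Measurable S.ofPhase := S.continuous_ofPhase.measurable

/-- Needed twice: for the measurability of the leapfrog flow, and, together with nonemptiness, for
conditional distributions. -/
instance : StandardBorelSpace S.State :=
  have := S.phaseHomeomorph.isClosedEmbedding.polishSpace
  inferInstance

instance : Nonempty S.State := ⟨S.ofPhase 0⟩

/-- With u = M_ν⁻¹p_ν one has p = Mu and p_z = νM_z∇ᵀξ u, so the two kinetic terms add up to ½uᵀ(M +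
ν²∇ξM_z∇ᵀξ)u. -/
theorem hamiltonian_ofPhase (y : (Fin d → ℝ) × (Fin d → ℝ)) :
    S.hamiltonian (S.ofPhase y) = S.penHamiltonian y := by
  obtain ⟨q, p⟩ := y
  simp only [hamiltonian, penHamiltonian, ofPhase, ExtPhase.q, ExtPhase.p, ExtPhase.pz]
  congr 2
  set u := (S.penMass q)⁻¹ *ᵥ p with hu
  have hp : p = S.penMass q *ᵥ u := by
    rw [hu, Matrix.mulVec_mulVec, Matrix.mul_nonsing_inv _ (S.isUnit_det_penMass q),
      Matrix.one_mulVec]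
  rw [Matrix.mulVec_mulVec _ S.M⁻¹, Matrix.nonsing_inv_mul _ S.isUnit_det_M, Matrix.one_mulVec,
    Matrix.mulVec_smul, Matrix.mulVec_mulVec _ S.Mz⁻¹, Matrix.nonsing_inv_mul _ S.isUnit_det_Mz,
    Matrix.one_mulVec, hp, penMass, Matrix.add_mulVec, Matrix.smul_mulVec, add_dotProduct,
    smul_dotProduct, smul_dotProduct, dotProduct_smul, ← Matrix.mulVec_mulVec,
    ← Matrix.mulVec_mulVec]
  have : (S.gradξ q *ᵥ (S.Mz *ᵥ ((S.gradξ q)ᵀ *ᵥ u))) ⬝ᵥ u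
      = (S.Mz *ᵥ ((S.gradξ q)ᵀ *ᵥ u)) ⬝ᵥ ((S.gradξ q)ᵀ *ᵥ u) := by
    rw [dotProduct_comm, Matrix.dotProduct_mulVec, dotProduct_comm, Matrix.mulVec_transpose]
  rw [this]
  simp only [smul_eq_mul]
  ring

theorem hamiltonian_eq (x : S.State) : S.hamiltonian x = S.penHamiltonian (S.toPhase x) := by
  rw [← hamiltonian_ofPhase, ofPhase_toPhase]

/-! ### Gaussian fibres of the Gibbs measure and the position marginal. -/

/-- The unnormalized Gibbs density on `ℝ^d × ℝ^d`. -/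
noncomputable def gibbs (y : (Fin d → ℝ) × (Fin d → ℝ)) : ENNReal :=
  ENNReal.ofReal (Real.exp (-S.β * S.penHamiltonian y))

theorem measurable_gibbs : Measurable S.gibbs :=
  (Real.measurable_exp.comp
    (S.continuous_penHamiltonian.measurable.const_mul _)).ennreal_ofReal

open scoped MatrixOrder Matrix.Norms.L2Operator in
/-- A square root of `β⁻¹ M_ν(q)`. -/
theorem exists_sqrt_penMass (q : Fin d → ℝ) :
    ∃ L : Matrix (Fin d) (Fin d) ℝ, L * Lᵀ = S.β⁻¹ • S.penMass q := by
  -- A non-negative element of a C*-algebra has the form B*B; over the reals L = Bᵀ then serves.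
  obtain ⟨B, hB⟩ := CStarAlgebra.nonneg_iff_eq_star_mul_self.1
    ((S.penMass_posDef q).posSemidef.smul (inv_nonneg.2 S.β_pos.le)).nonneg
  exact ⟨Bᵀ, by rw [hB, Matrix.transpose_transpose, Matrix.star_eq_conjTranspose,
    Matrix.conjTranspose_eq_transpose_of_trivial]⟩

/-- The normalization of the Gaussian momentum distribution. -/
noncomputable def momConst (d : ℕ) (β : ℝ) : ENNReal :=
  ENNReal.ofReal (Real.sqrt (β⁻¹ ^ d) * Real.sqrt (2 * Real.pi) ^ d)

/-- Substitute p = Lw. The kinetic exponent becomes -½|w|², and the Jacobian |det L| = β^{-d/2}√det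
M_ν loses its dependence on q against exp(-βV_fix). This is the purpose of the Fixman corrector. -/
theorem lintegral_gibbs_fibre (q : Fin d → ℝ) {L : Matrix (Fin d) (Fin d) ℝ}
    (hL : L * Lᵀ = S.β⁻¹ • S.penMass q) {f : (Fin d → ℝ) → ENNReal} (hf : Measurable f) :
    ∫⁻ p, S.gibbs (q, p) * f p = momConst d S.β * ENNReal.ofReal (Real.exp (-S.β * S.V q)) *
      ∫⁻ w, f (L *ᵥ w) ∂stdGaussianPi d := by
  have hβ := S.β_pos
  have hdet : 0 < (S.penMass q).det := (S.penMass_posDef q).det_pos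
  have hd2 : L.det * L.det = S.β⁻¹ ^ d * (S.penMass q).det := by
    have := congrArg Matrix.det hL
    rwa [Matrix.det_mul, Matrix.det_transpose, Matrix.det_smul, Fintype.card_fin] at this
  have hLd : L.det ≠ 0 := by
    intro h
    rw [h, zero_mul] at hd2
    exact (mul_pos (pow_pos (inv_pos.2 hβ) d) hdet).ne hd2
  have habs : |L.det| = Real.sqrt (S.β⁻¹ ^ d) * Real.sqrt (S.penMass q).det := by
    rw [← Real.sqrt_mul (by positivity), ← hd2, Real.sqrt_mul_self_eq_abs]
  have hLu : IsUnit L.det := isUnit_iff_ne_zero.2 hLd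
  have hinv : (S.penMass q)⁻¹ = S.β⁻¹ • (Lᵀ⁻¹ * L⁻¹) := by
    apply Matrix.inv_eq_left_inv
    have : S.penMass q = S.β • (L * Lᵀ) := by
      rw [hL, smul_smul, mul_inv_cancel₀ hβ.ne', one_smul]
    rw [this, Matrix.smul_mul, Matrix.mul_smul, smul_smul, inv_mul_cancel₀ hβ.ne', one_smul,
      Matrix.mul_assoc, ← Matrix.mul_assoc L⁻¹, Matrix.nonsing_inv_mul _ hLu, Matrix.one_mul,
      Matrix.nonsing_inv_mul _ (by rwa [Matrix.det_transpose])]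
  have hquad : ∀ w, (L *ᵥ w) ⬝ᵥ ((S.penMass q)⁻¹ *ᵥ (L *ᵥ w)) = S.β⁻¹ * (w ⬝ᵥ w) := by
    intro w
    rw [hinv, Matrix.smul_mulVec, dotProduct_smul, smul_eq_mul, ← Matrix.mulVec_mulVec,
      Matrix.mulVec_mulVec _ L⁻¹, Matrix.nonsing_inv_mul _ hLu, Matrix.one_mulVec]
    congr 1
    rw [Matrix.dotProduct_mulVec, ← Matrix.transpose_nonsing_inv, Matrix.vecMul_transpose,
      Matrix.mulVec_mulVec, Matrix.nonsing_inv_mul _ hLu, Matrix.one_mulVec]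
  have hfix : Real.exp (-S.β * S.fixman q) = (Real.sqrt (S.penMass q).det)⁻¹ := by
    have : -S.β * S.fixman q = -(Real.log (S.penMass q).det / 2) := by
      unfold fixman; field_simp
    rw [this, Real.exp_neg, Real.exp_half, Real.exp_log hdet]
  have hm : Measurable fun p => S.gibbs (q, p) * f p :=
    (S.measurable_gibbs.comp measurable_prodMk_left).mul hf
  have hfL : Measurable fun w => f (L *ᵥ w) :=
    hf.comp (Continuous.measurable (by fun_prop))
  have hsq : 0 < Real.sqrt (S.penMass q).det := Real.sqrt_pos.2 hdet
  rw [lintegral_eq_det_mul_lintegral_mulVec hLd hm]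
  have : ∀ w, S.gibbs (q, L *ᵥ w) * f (L *ᵥ w)
      = ENNReal.ofReal (Real.exp (-S.β * S.V q) * (Real.sqrt (S.penMass q).det)⁻¹)
        * (ENNReal.ofReal (Real.exp (-(1 / 2 * (w ⬝ᵥ w)))) * f (L *ᵥ w)) := by
    intro w
    rw [← mul_assoc, ← ENNReal.ofReal_mul (by positivity), gibbs, penHamiltonian, ← hfix,
      ← Real.exp_add, ← Real.exp_add]
    simp only [hquad]
    congr 3
    field_simp
    ring
  simp only [this]
  rw [lintegral_const_mul' _ _ ENNReal.ofReal_ne_top, lintegral_exp_mul hfL, ← mul_assoc,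
    ← mul_assoc, ← ENNReal.ofReal_mul (by positivity), ← ENNReal.ofReal_mul (by positivity),
    momConst, ← ENNReal.ofReal_mul (by positivity), habs]
  congr 2
  field_simp

theorem momConst_ne_zero {β : ℝ} (hβ : 0 < β) : momConst d β ≠ 0 :=
  (ENNReal.ofReal_pos.2 (by positivity)).ne'

theorem momConst_ne_top (β : ℝ) : momConst d β ≠ ⊤ := ENNReal.ofReal_ne_top

theorem lintegral_gibbs_mul_comp_fst {f : (Fin d → ℝ) → ENNReal} (hf : Measurable f) :
    ∫⁻ y, S.gibbs y * f y.1
      = momConst d S.β * ∫⁻ q, ENNReal.ofReal (Real.exp (-S.β * S.V q)) * f q := by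
  rw [Measure.volume_eq_prod,
    lintegral_prod (fun y => S.gibbs y * f y.1)
      (S.measurable_gibbs.mul (hf.comp measurable_fst)).aemeasurable,
    ← lintegral_const_mul' _ _ (momConst_ne_top _)]
  refine lintegral_congr fun q => ?_
  obtain ⟨L, hL⟩ := S.exists_sqrt_penMass q
  simp only [S.lintegral_gibbs_fibre q hL (f := fun _ => f q) measurable_const, lintegral_const,
    measure_univ, mul_one]
  ring

theorem lintegral_gibbs : ∫⁻ y, S.gibbs y
      = momConst d S.β * ∫⁻ q, ENNReal.ofReal (Real.exp (-S.β * S.V q)) := by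
  simpa using S.lintegral_gibbs_mul_comp_fst (f := fun _ => 1) measurable_const

theorem lintegral_exp_V_ne_zero :
    ∫⁻ q, ENNReal.ofReal (Real.exp (-S.β * S.V q)) ≠ 0 := by
  have hm : Measurable fun q => ENNReal.ofReal (Real.exp (-S.β * S.V q)) :=
    (Real.measurable_exp.comp (S.V_contDiff.continuous.measurable.const_mul _)).ennreal_ofReal
  refine ((lintegral_pos_iff_support hm).2 ?_).ne'
  have : (Function.support fun q => ENNReal.ofReal (Real.exp (-S.β * S.V q))) = Set.univ := by
    ext q; simp [Real.exp_pos]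
  rw [this]
  exact Measure.measure_univ_pos.2 (NeZero.ne _)

theorem penCanonical_eq :
    S.penCanonical = (∫⁻ y, S.gibbs y)⁻¹ • volume.withDensity S.gibbs := rfl

variable {S} in
theorem lintegral_gibbs_ne_top
    (hZ : Integrable (fun q : Fin d → ℝ => Real.exp (-S.β * S.V q))) : ∫⁻ y, S.gibbs y ≠ ⊤ := by
  rw [lintegral_gibbs]
  exact ENNReal.mul_ne_top (momConst_ne_top _) hZ.lintegral_lt_top.ne

theorem lintegral_gibbs_ne_zero : ∫⁻ y, S.gibbs y ≠ 0 := by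
  rw [lintegral_gibbs]
  exact mul_ne_zero (momConst_ne_zero S.β_pos) S.lintegral_exp_V_ne_zero

variable {S} in
theorem isProbabilityMeasure_penCanonical
    (hZ : Integrable (fun q : Fin d → ℝ => Real.exp (-S.β * S.V q))) :
    IsProbabilityMeasure S.penCanonical := by
  constructor
  rw [penCanonical_eq, Measure.smul_apply, withDensity_apply _ MeasurableSet.univ,
    Measure.restrict_univ, smul_eq_mul,
    ENNReal.inv_mul_cancel S.lintegral_gibbs_ne_zero (lintegral_gibbs_ne_top hZ)]

/-- The factor `momConst` occurs in both the integral over A and the normalization, and cancels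
because it is finite and nonzero. -/
theorem map_fst_penCanonical : S.penCanonical.map Prod.fst = positionCanonical S.β S.V := by
  ext A hA
  have h := S.lintegral_gibbs_mul_comp_fst (f := A.indicator 1) (measurable_one.indicator hA)
  have h1 : ∀ y : (Fin d → ℝ) × (Fin d → ℝ), S.gibbs y * A.indicator 1 y.1
      = (Prod.fst ⁻¹' A).indicator S.gibbs y := by
    intro y
    by_cases hy : y.1 ∈ A <;> simp [hy, Set.indicator]
  have h2 : ∀ q, ENNReal.ofReal (Real.exp (-S.β * S.V q)) * A.indicator 1 q
      = A.indicator (fun q => ENNReal.ofReal (Real.exp (-S.β * S.V q))) q := by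
    intro q
    by_cases hq : q ∈ A <;> simp [hq]
  simp only [h1, h2] at h
  rw [lintegral_indicator (measurable_fst hA), lintegral_indicator hA] at h
  rw [Measure.map_apply measurable_fst hA, penCanonical_eq, positionCanonical, Measure.smul_apply,
    Measure.smul_apply, withDensity_apply _ hA, withDensity_apply _ (measurable_fst hA), h,
    lintegral_gibbs, smul_eq_mul, smul_eq_mul,
    ENNReal.mul_inv (Or.inl (momConst_ne_zero S.β_pos)) (Or.inl (momConst_ne_top _)),
    mul_mul_mul_comm, ENNReal.inv_mul_cancel (momConst_ne_zero S.β_pos) (momConst_ne_top _),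
    one_mul]

/-! ### The leapfrog step as a discrete Legendre transform. -/

/-- The momentum `p_ν` at `q` that sends the leapfrog step from the position `q` to `q'`. -/
noncomputable def genMomentum (q q' : Fin d → ℝ) : Fin d → ℝ :=
  S.δt⁻¹ • (S.M *ᵥ (q' - q) + S.ν ^ 2 • (S.gradξ q *ᵥ (S.Mz *ᵥ (S.ξ q' - S.ξ q))))
    + (S.δt / 2) • S.gradPot q

/-- The momentum constraint turns ν²∇ξM_z∇ᵀξM⁻¹p into ν∇ξp_z. In this form a multiplier contributes
-∇ξλ + ∇ξλ = 0. -/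
theorem toPhase_snd (x : S.State) :
    (S.toPhase x).2 = x.1.p + S.ν • (S.gradξ x.1.q *ᵥ x.1.pz) := by
  have h2 : (S.gradξ x.1.q)ᵀ *ᵥ (S.M⁻¹ *ᵥ x.1.p) = S.ν⁻¹ • (S.Mz⁻¹ *ᵥ x.1.pz) := x.2.2
  simp only [toPhase, penMass]
  rw [Matrix.add_mulVec, Matrix.mulVec_mulVec _ S.M, Matrix.mul_nonsing_inv _ S.isUnit_det_M,
    Matrix.one_mulVec, Matrix.smul_mulVec, ← Matrix.mulVec_mulVec, ← Matrix.mulVec_mulVec, h2,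
    Matrix.mulVec_smul, Matrix.mulVec_mulVec _ S.Mz, Matrix.mul_nonsing_inv _ S.isUnit_det_Mz,
    Matrix.one_mulVec, Matrix.mulVec_smul, smul_smul]
  congr 2
  have := S.ν_pos.ne'
  field_simp

/-- The two positions determine the half-step impulses: δt p̄ = M(q'-q), and δt p̄_z =
νM_z(ξ(q')-ξ(q)) by the position constraints. Forming p_ν at either end removes the multipliers. -/
theorem rattleStep_iff (x y : S.State) :
    S.RattleStep x y ↔ (S.toPhase x).2 = S.genMomentum x.1.q y.1.q ∧
      (S.toPhase y).2 = -S.genMomentum y.1.q x.1.q := by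
  have hν := S.ν_pos.ne'
  have hδ := S.δt_pos.ne'
  have hx : S.ξ x.1.q = S.ν⁻¹ • x.1.z := x.2.1
  have hy : S.ξ y.1.q = S.ν⁻¹ • y.1.z := y.2.1
  rw [toPhase_snd, toPhase_snd]
  have hMM : ∀ v, S.M *ᵥ (S.M⁻¹ *ᵥ v) = v := fun v => by
    rw [Matrix.mulVec_mulVec, Matrix.mul_nonsing_inv _ S.isUnit_det_M, Matrix.one_mulVec]
  have hMM' : ∀ v, S.M⁻¹ *ᵥ (S.M *ᵥ v) = v := fun v => by
    rw [Matrix.mulVec_mulVec, Matrix.nonsing_inv_mul _ S.isUnit_det_M, Matrix.one_mulVec]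
  have hZZ : ∀ v, S.Mz *ᵥ (S.Mz⁻¹ *ᵥ v) = v := fun v => by
    rw [Matrix.mulVec_mulVec, Matrix.mul_nonsing_inv _ S.isUnit_det_Mz, Matrix.one_mulVec]
  have hZZ' : ∀ v, S.Mz⁻¹ *ᵥ (S.Mz *ᵥ v) = v := fun v => by
    rw [Matrix.mulVec_mulVec, Matrix.nonsing_inv_mul _ S.isUnit_det_Mz, Matrix.one_mulVec]
  constructor
  · rintro ⟨l₁, l₂, ph, pzh, h1, h2, h3, h4, -, h6, h7, -⟩
    have e1 : S.M *ᵥ (y.1.q - x.1.q) = S.δt • ph := by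
      rw [h3, add_sub_cancel_left, Matrix.mulVec_smul, hMM]
    have e2 : S.Mz *ᵥ (S.ξ y.1.q - S.ξ x.1.q) = (S.ν⁻¹ * S.δt) • pzh := by
      rw [hx, hy, h4, smul_add, add_sub_cancel_left, Matrix.mulVec_smul, Matrix.mulVec_smul, hZZ,
        smul_smul]
    have e3 : S.M *ᵥ (x.1.q - y.1.q) = -(S.δt • ph) := by
      rw [← e1, ← Matrix.mulVec_neg, neg_sub]
    have e4 : S.Mz *ᵥ (S.ξ x.1.q - S.ξ y.1.q) = -((S.ν⁻¹ * S.δt) • pzh) := by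
      rw [← e2, ← Matrix.mulVec_neg, neg_sub]
    constructor
    · rw [genMomentum, e1, e2, h1, h2]
      simp only [Matrix.mulVec_smul, Matrix.mulVec_add]
      match_scalars <;> field_simp <;> ring
    · rw [genMomentum, e3, e4, h6, h7]
      simp only [Matrix.mulVec_smul, Matrix.mulVec_add, Matrix.mulVec_neg]
      match_scalars <;> field_simp <;> ring
  · rintro ⟨h1, h2⟩
    have e3 : S.M *ᵥ (x.1.q - y.1.q) = -(S.M *ᵥ (y.1.q - x.1.q)) := by
      rw [← Matrix.mulVec_neg, neg_sub]
    have e4 : S.Mz *ᵥ (S.ξ x.1.q - S.ξ y.1.q) = -(S.Mz *ᵥ (S.ξ y.1.q - S.ξ x.1.q)) := by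
      rw [← Matrix.mulVec_neg, neg_sub]
    rw [genMomentum, e3, e4] at h2
    rw [genMomentum] at h1
    -- The multipliers are read off from the p_z equations: λ = ν(p̄_z - p_z) and λ' = ν(p'_z -
    -- p̄_z).
    refine ⟨S.ν • (((S.δt⁻¹ * S.ν) • (S.Mz *ᵥ (S.ξ y.1.q - S.ξ x.1.q))) - x.1.pz),
      S.ν • (y.1.pz - ((S.δt⁻¹ * S.ν) • (S.Mz *ᵥ (S.ξ y.1.q - S.ξ x.1.q)))),
      S.δt⁻¹ • (S.M *ᵥ (y.1.q - x.1.q)),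
      (S.δt⁻¹ * S.ν) • (S.Mz *ᵥ (S.ξ y.1.q - S.ξ x.1.q)), ?_, ?_, ?_, ?_, y.2.1, ?_, ?_, y.2.2⟩
    · rw [eq_sub_of_add_eq h1]
      simp only [Matrix.mulVec_smul, Matrix.mulVec_sub]
      match_scalars <;> field_simp <;> ring
    · match_scalars <;> field_simp <;> ring
    · rw [Matrix.mulVec_smul, hMM', smul_smul, mul_inv_cancel₀ hδ, one_smul, add_sub_cancel]
    · rw [Matrix.mulVec_smul, hZZ', hx, hy]
      match_scalars <;> field_simp <;> ring
    · rw [eq_sub_of_add_eq h2]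
      simp only [Matrix.mulVec_smul, Matrix.mulVec_sub, Matrix.mulVec_neg]
      match_scalars <;> field_simp
    · match_scalars <;> field_simp <;> ring

theorem rattleFlow_spec (h : S.RattleGlobal) (x : S.State) : S.RattleStep x (rattleFlow h x) :=
  (h x).choose_spec.1

theorem rattleFlow_eq (h : S.RattleGlobal) {x y : S.State} (hxy : S.RattleStep x y) :
    rattleFlow h x = y :=
  Subtype.ext ((h x).unique (S.rattleFlow_spec h x) hxy)

/-- The map `(q, q') ↦ (q, p_ν)`, from pairs of successive positions to phase space. -/
noncomputable def discreteLegendre (y : (Fin d → ℝ) × (Fin d → ℝ)) :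
    (Fin d → ℝ) × (Fin d → ℝ) := (y.1, S.genMomentum y.1 y.2)

theorem rattleFlow_ofPhase_genMomentum (h : S.RattleGlobal) (q q' : Fin d → ℝ) :
    rattleFlow h (S.ofPhase (q, S.genMomentum q q')) = S.ofPhase (q', -S.genMomentum q' q) := by
  refine S.rattleFlow_eq h ((S.rattleStep_iff _ _).2 ?_)
  rw [toPhase_ofPhase, toPhase_ofPhase]
  exact ⟨rfl, rfl⟩

/-- Injectivity comes from uniqueness of the outcome, whose position is q'; surjectivity comes from
existence of an outcome. -/
theorem bijective_genMomentum (h : S.RattleGlobal) (q : Fin d → ℝ) :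
    Function.Bijective (S.genMomentum q) := by
  constructor
  · intro a b hab
    have ha := S.rattleFlow_ofPhase_genMomentum h q a
    rw [hab, S.rattleFlow_ofPhase_genMomentum h q b] at ha
    exact (congrArg (fun x : S.State => x.1.q) ha).symm
  · intro p
    have hs := ((S.rattleStep_iff _ _).1 (S.rattleFlow_spec h (S.ofPhase (q, p)))).1
    rw [toPhase_ofPhase] at hs
    exact ⟨_, hs.symm⟩

theorem bijective_discreteLegendre (h : S.RattleGlobal) :
    Function.Bijective S.discreteLegendre := by
  constructor
  · rintro ⟨a, b⟩ ⟨a', b'⟩ hab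
    simp only [discreteLegendre, Prod.mk.injEq] at hab
    obtain ⟨rfl, hb⟩ := hab
    rw [(S.bijective_genMomentum h a).1 hb]
  · rintro ⟨q, p⟩
    obtain ⟨q', hq'⟩ := (S.bijective_genMomentum h q).2 p
    exact ⟨(q, q'), by simp [discreteLegendre, hq']⟩

theorem measurable_discreteLegendre : Measurable S.discreteLegendre := by
  have hξ := S.ξ_contDiff.continuous
  have hg : Continuous fun y : (Fin d → ℝ) × (Fin d → ℝ) => S.gradξ y.1 :=
    S.continuous_gradξ.comp continuous_fst
  have h1 : Continuous fun y : (Fin d → ℝ) × (Fin d → ℝ) => S.δt⁻¹ • (S.M *ᵥ (y.2 - y.1)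
      + S.ν ^ 2 • (S.gradξ y.1 *ᵥ (S.Mz *ᵥ (S.ξ y.2 - S.ξ y.1)))) := by
    have h2 : Continuous fun y : (Fin d → ℝ) × (Fin d → ℝ) => S.Mz *ᵥ (S.ξ y.2 - S.ξ y.1) :=
      continuous_const.matrix_mulVec (by fun_prop)
    have h3 : Continuous fun y : (Fin d → ℝ) × (Fin d → ℝ) => S.M *ᵥ (y.2 - y.1) :=
      continuous_const.matrix_mulVec (by fun_prop)
    exact (h3.add ((hg.matrix_mulVec h2).const_smul (S.ν ^ 2))).const_smul S.δt⁻¹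
  have h2 : Measurable fun y : (Fin d → ℝ) × (Fin d → ℝ) => S.gradPot y.1 :=
    S.measurable_gradPot.comp measurable_fst
  exact measurable_fst.prodMk (h1.measurable.add (h2.const_smul (S.δt / 2)))

/-- Reversal of the momentum in phase space. -/
def negSnd (y : (Fin d → ℝ) × (Fin d → ℝ)) : (Fin d → ℝ) × (Fin d → ℝ) := (y.1, -y.2)

theorem measurable_negSnd : Measurable (negSnd (d := d)) :=
  measurable_fst.prodMk measurable_snd.neg

theorem measurePreserving_negSnd :
    MeasurePreserving (negSnd (d := d)) volume volume :=
  (MeasurePreserving.id volume).prod (Measure.measurePreserving_neg volume)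

theorem reverse_ofPhase (y : (Fin d → ℝ) × (Fin d → ℝ)) :
    S.reverse (S.ofPhase y) = S.ofPhase (negSnd y) := by
  apply Subtype.ext
  simp only [reverse, ExtPhase.reverse, ofPhase, negSnd, ExtPhase.q, ExtPhase.z, ExtPhase.p,
    ExtPhase.pz, Matrix.mulVec_neg, smul_neg]

theorem rattleFlow_discreteLegendre (h : S.RattleGlobal) (y : (Fin d → ℝ) × (Fin d → ℝ)) :
    rattleFlow h (S.ofPhase (S.discreteLegendre y))
      = S.ofPhase (negSnd (S.discreteLegendre y.swap)) :=
  S.rattleFlow_ofPhase_genMomentum h y.1 y.2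

/-- The flow is defined by choice, but its composition with a measurable surjection is explicit.
Between standard Borel spaces this suffices, by a Lusin–Souslin argument. -/
theorem measurable_rattleFlow (h : S.RattleGlobal) : Measurable (rattleFlow h) := by
  have hsurj : Function.Surjective (S.ofPhase ∘ S.discreteLegendre) :=
    S.phaseHomeomorph.symm.surjective.comp (S.bijective_discreteLegendre h).2
  have hm : Measurable (S.ofPhase ∘ S.discreteLegendre) :=
    S.measurable_ofPhase.comp S.measurable_discreteLegendre
  refine (hm.measurable_comp_iff_of_surjective hsurj).1 ?_
  have : rattleFlow h ∘ S.ofPhase ∘ S.discreteLegendre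
      = fun y => S.ofPhase (negSnd (S.discreteLegendre y.swap)) :=
    funext fun y => S.rattleFlow_discreteLegendre h y
  rw [this]
  exact S.measurable_ofPhase.comp (measurable_negSnd.comp
    (S.measurable_discreteLegendre.comp measurable_swap))

/-- The Jacobian matrix of `q' ↦ p_ν`. -/
noncomputable def legendreJacobian (y : (Fin d → ℝ) × (Fin d → ℝ)) : Matrix (Fin d) (Fin d) ℝ :=
  S.δt⁻¹ • (S.M + S.ν ^ 2 • (S.gradξ y.1 * S.Mz * (S.gradξ y.2)ᵀ))

/-- The matrix is minus the mixed second derivative of the discrete Lagrangian, which is symmetric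
in its two positions. -/
theorem legendreJacobian_swap (y : (Fin d → ℝ) × (Fin d → ℝ)) :
    S.legendreJacobian y.swap = (S.legendreJacobian y)ᵀ := by
  simp [legendreJacobian, Matrix.transpose_add, Matrix.transpose_smul, Matrix.transpose_mul,
    S.transpose_M, S.transpose_Mz, Matrix.mul_assoc]

theorem measurable_legendreJacobian_det :
    Measurable fun y => ENNReal.ofReal |(S.legendreJacobian y).det| := by
  have h1 : Continuous fun y : (Fin d → ℝ) × (Fin d → ℝ) => S.gradξ y.1 :=
    S.continuous_gradξ.comp continuous_fst
  have h2 : Continuous fun y : (Fin d → ℝ) × (Fin d → ℝ) => S.gradξ y.2 :=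
    S.continuous_gradξ.comp continuous_snd
  have : Continuous S.legendreJacobian := by
    unfold legendreJacobian
    fun_prop
  exact this.matrix_det.abs.measurable.ennreal_ofReal

theorem gradξ_transpose_mulVec (q v : Fin d → ℝ) :
    (S.gradξ q)ᵀ *ᵥ v = fderiv ℝ S.ξ q v := by
  conv_rhs => rw [← Finset.univ_sum_single v, map_sum]
  ext i
  simp only [Matrix.mulVec, dotProduct, gradξ, Matrix.transpose_apply, Matrix.of_apply,
    Finset.sum_apply]
  refine Finset.sum_congr rfl fun j _ => ?_
  have : Pi.single j (v j) = v j • (Pi.single j 1 : Fin d → ℝ) := by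
    rw [← Pi.single_smul, smul_eq_mul, mul_one]
  rw [this, map_smul, Pi.smul_apply, smul_eq_mul, mul_comm]

/-- Only q' varies, so the force at q is a constant and no second derivative of V is needed. -/
theorem hasFDerivAt_genMomentum (q q' : Fin d → ℝ) :
    HasFDerivAt (S.genMomentum q)
      (Matrix.toLin' (S.legendreJacobian (q, q'))).toContinuousLinearMap q' := by
  have hξ : HasFDerivAt S.ξ (fderiv ℝ S.ξ q') q' :=
    (S.ξ_contDiff.differentiable (by norm_num) q').hasFDerivAt
  have h1 : HasFDerivAt (fun q' => S.M *ᵥ (q' - q))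
      ((Matrix.toLin' S.M).toContinuousLinearMap ∘L (ContinuousLinearMap.id ℝ _)) q' :=
    (Matrix.toLin' S.M).toContinuousLinearMap.hasFDerivAt.comp q' ((hasFDerivAt_id q').sub_const q)
  have h2 : HasFDerivAt (fun q' => S.gradξ q *ᵥ (S.Mz *ᵥ (S.ξ q' - S.ξ q)))
      (((Matrix.toLin' (S.gradξ q)).toContinuousLinearMap ∘L
        (Matrix.toLin' S.Mz).toContinuousLinearMap) ∘L (fderiv ℝ S.ξ q')) q' :=
    ((Matrix.toLin' (S.gradξ q)).toContinuousLinearMap ∘L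
      (Matrix.toLin' S.Mz).toContinuousLinearMap).hasFDerivAt.comp q' (hξ.sub_const (S.ξ q))
  refine (((h1.add (h2.const_smul (S.ν ^ 2))).const_smul S.δt⁻¹).add_const
    ((S.δt / 2) • S.gradPot q)).congr_fderiv ?_
  ext1 v
  simp [legendreJacobian, gradξ_transpose_mulVec]

/-- The map fixes q, so Fubini reduces the change of variables to q' ↦ p_ν on each fibre. -/
theorem lintegral_eq_lintegral_discreteLegendre (h : S.RattleGlobal)
    {g : (Fin d → ℝ) × (Fin d → ℝ) → ENNReal} (hg : Measurable g) :
    ∫⁻ y, g y = ∫⁻ y, ENNReal.ofReal |(S.legendreJacobian y).det| * g (S.discreteLegendre y) := by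
  rw [Measure.volume_eq_prod, lintegral_prod _ hg.aemeasurable, lintegral_prod
    (fun y => ENNReal.ofReal |(S.legendreJacobian y).det| * g (S.discreteLegendre y))
    (S.measurable_legendreJacobian_det.mul (hg.comp S.measurable_discreteLegendre)).aemeasurable]
  refine lintegral_congr fun q => ?_
  have := lintegral_image_eq_lintegral_abs_det_fderiv_mul volume MeasurableSet.univ
    (fun q' _ => (S.hasFDerivAt_genMomentum q q').hasFDerivWithinAt)
    (S.bijective_genMomentum h q).1.injOn (fun p => g (q, p))
  rw [Set.image_univ, (S.bijective_genMomentum h q).2.range_eq, Measure.restrict_univ] at this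
  rw [this]
  refine lintegral_congr fun q' => ?_
  rw [ContinuousLinearMap.det, LinearMap.coe_toContinuousLinearMap, LinearMap.det_toLin']
  rfl

/-! ### Volume preservation and time reversibility of the leapfrog flow. -/

/-- The phase space measure `dq dp_ν` on the constrained phase space. -/
noncomputable def stateVolume : Measure S.State := volume.map S.ofPhase

theorem lintegral_stateVolume {f : S.State → ENNReal} (hf : Measurable f) :
    ∫⁻ x, f x ∂S.stateVolume = ∫⁻ y, f (S.ofPhase y) :=
  lintegral_map hf S.measurable_ofPhase

/-- Pull back along F, exchange q and q', which keeps |det|, push forward along F, and absorb the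
momentum reversal. -/
theorem lintegral_comp_rattleFlow (h : S.RattleGlobal) {f : S.State → ENNReal}
    (hf : Measurable f) : ∫⁻ x, f (rattleFlow h x) ∂S.stateVolume = ∫⁻ x, f x ∂S.stateVolume := by
  have hΨ := S.measurable_rattleFlow h
  have hg : Measurable fun y => f (S.ofPhase (negSnd y)) :=
    hf.comp (S.measurable_ofPhase.comp measurable_negSnd)
  calc ∫⁻ x, f (rattleFlow h x) ∂S.stateVolume
      = ∫⁻ y, f (rattleFlow h (S.ofPhase y)) := S.lintegral_stateVolume (hf.comp hΨ)
    _ = ∫⁻ y, ENNReal.ofReal |(S.legendreJacobian y).det|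
          * f (rattleFlow h (S.ofPhase (S.discreteLegendre y))) :=
        S.lintegral_eq_lintegral_discreteLegendre h (hf.comp (hΨ.comp S.measurable_ofPhase))
    _ = ∫⁻ y : (Fin d → ℝ) × (Fin d → ℝ), ENNReal.ofReal |(S.legendreJacobian y.swap).det|
          * f (S.ofPhase (negSnd (S.discreteLegendre y.swap))) := by
        refine lintegral_congr fun y => ?_
        rw [rattleFlow_discreteLegendre, legendreJacobian_swap, Matrix.det_transpose]
    _ = ∫⁻ y, ENNReal.ofReal |(S.legendreJacobian y).det|
          * f (S.ofPhase (negSnd (S.discreteLegendre y))) :=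
        Measure.measurePreserving_swap.lintegral_comp
          (S.measurable_legendreJacobian_det.mul (hg.comp S.measurable_discreteLegendre))
    _ = ∫⁻ y, f (S.ofPhase (negSnd y)) := (S.lintegral_eq_lintegral_discreteLegendre h hg).symm
    _ = ∫⁻ y, f (S.ofPhase y) :=
        measurePreserving_negSnd.lintegral_comp (hf.comp S.measurable_ofPhase)
    _ = ∫⁻ x, f x ∂S.stateVolume := (S.lintegral_stateVolume hf).symm

theorem measurePreserving_rattleFlow (h : S.RattleGlobal) :
    MeasurePreserving (rattleFlow h) S.stateVolume S.stateVolume := by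
  refine ⟨S.measurable_rattleFlow h, Measure.ext_of_lintegral _ fun f hf => ?_⟩
  rw [lintegral_map hf (S.measurable_rattleFlow h), S.lintegral_comp_rattleFlow h hf]

theorem reverse_eq (x : S.State) : S.reverse x = S.ofPhase (negSnd (S.toPhase x)) := by
  rw [← reverse_ofPhase, ofPhase_toPhase]

theorem measurable_reverse : Measurable S.reverse := by
  have : S.reverse = fun x => S.ofPhase (negSnd (S.toPhase x)) := funext S.reverse_eq
  rw [this]
  exact S.measurable_ofPhase.comp (measurable_negSnd.comp S.measurable_toPhase)

theorem measurePreserving_reverse :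
    MeasurePreserving S.reverse S.stateVolume S.stateVolume := by
  refine ⟨S.measurable_reverse, Measure.ext_of_lintegral _ fun f hf => ?_⟩
  rw [lintegral_map hf S.measurable_reverse, S.lintegral_stateVolume hf,
    S.lintegral_stateVolume (f := fun x => f (S.reverse x)) (hf.comp S.measurable_reverse)]
  simp only [reverse_ofPhase]
  exact measurePreserving_negSnd.lintegral_comp (hf.comp S.measurable_ofPhase)

theorem reverse_reverse (x : S.State) : S.reverse (S.reverse x) = x := by
  apply Subtype.ext
  simp only [reverse, ExtPhase.reverse, ExtPhase.q, ExtPhase.z, ExtPhase.p, ExtPhase.pz, neg_neg]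

/-- The constrained leapfrog scheme is time-reversible. -/
theorem rattleFlow_reverse_rattleFlow (h : S.RattleGlobal) (x : S.State) :
    rattleFlow h (S.reverse (rattleFlow h x)) = S.reverse x := by
  obtain ⟨y, hy⟩ := (S.bijective_discreteLegendre h).2 (S.toPhase x)
  have hx : x = S.ofPhase (S.discreteLegendre y) := by rw [hy, ofPhase_toPhase]
  have hneg : ∀ v : (Fin d → ℝ) × (Fin d → ℝ), negSnd (negSnd v) = v := fun v => by simp [negSnd]
  -- F(q,q') flows to N F(q',q); its reversal F(q',q) flows to N F(q,q').
  rw [hx, rattleFlow_discreteLegendre, reverse_ofPhase, hneg, rattleFlow_discreteLegendre,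
    Prod.swap_swap, reverse_ofPhase]

theorem hamiltonian_reverse (x : S.State) : S.hamiltonian (S.reverse x) = S.hamiltonian x := by
  simp only [hamiltonian, reverse, ExtPhase.reverse, ExtPhase.q, ExtPhase.p, ExtPhase.pz,
    Matrix.mulVec_neg, dotProduct_neg, neg_dotProduct, neg_neg]

/-! ### The fluctuation/dissipation step. -/

/-- Penalized dissipation matrix `γ + ν² ∇ξ γ_z ∇ᵀξ`. -/
noncomputable def penFriction (q : Fin d → ℝ) : Matrix (Fin d) (Fin d) ℝ :=
  S.γ + S.ν ^ 2 • (S.gradξ q * S.γz * (S.gradξ q)ᵀ)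

theorem penFriction_posSemidef (q : Fin d → ℝ) : (S.penFriction q).PosSemidef := by
  refine S.γ_posSemidef.add ?_
  have h := S.γz_posSemidef.mul_mul_conjTranspose_same (S.gradξ q)
  rw [Matrix.conjTranspose_eq_transpose_of_trivial] at h
  exact h.smul (sq_nonneg S.ν)

theorem transpose_penFriction (q : Fin d → ℝ) : (S.penFriction q)ᵀ = S.penFriction q := by
  simpa [Matrix.conjTranspose_eq_transpose_of_trivial] using
    (S.penFriction_posSemidef q).isHermitian.eq

/-- The matrix `M_ν + (δt / 2) γ_ν` of the mid-point scheme. -/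
noncomputable def midMass (q : Fin d → ℝ) : Matrix (Fin d) (Fin d) ℝ :=
  S.penMass q + (S.δt / 2) • S.penFriction q

theorem isUnit_det_midMass (q : Fin d → ℝ) : IsUnit (S.midMass q).det :=
  (Matrix.isUnit_iff_isUnit_det _).1 ((S.penMass_posDef q).add_posSemidef
    ((S.penFriction_posSemidef q).smul (half_pos S.δt_pos).le)).isUnit

theorem transpose_midMass (q : Fin d → ℝ) : (S.midMass q)ᵀ = S.midMass q := by
  rw [midMass, Matrix.transpose_add, Matrix.transpose_smul, transpose_penMass,
    transpose_penFriction]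

/-- The fluctuation/dissipation update of `p_ν` at the position `q`. -/
noncomputable def midUpdate (q p : Fin d → ℝ) (u : (Fin d → ℝ) × (Fin n → ℝ)) : Fin d → ℝ :=
  (S.penMass q * (S.midMass q)⁻¹) *ᵥ
    ((S.penMass q - (S.δt / 2) • S.penFriction q) *ᵥ ((S.penMass q)⁻¹ *ᵥ p)
      + Real.sqrt S.δt • (S.σ *ᵥ u.1 + S.ν • (S.gradξ q *ᵥ (S.σz *ᵥ u.2))))

theorem flucDiss_spec (x : S.State) (u : (Fin d → ℝ) × (Fin n → ℝ)) :
    S.FlucDissStep x u (S.flucDiss x u) :=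
  (S.existsUnique_flucDissStep x u).choose_spec.1

/-- With v = M⁻¹p the constraint gives M_z⁻¹p_z = ν∇ᵀξ v. Forming p_ν removes the multiplier and
leaves M_ν v₂ = M_ν v₁ - (δt/2)γ_ν(v₁+v₂) + noise, which is then solved for v₂. -/
theorem toPhase_flucDiss (x : S.State) (u : (Fin d → ℝ) × (Fin n → ℝ)) :
    S.toPhase (S.flucDiss x u) = (x.1.q, S.midUpdate x.1.q (S.toPhase x).2 u) := by
  obtain ⟨hq, -, ⟨l, hp, hpz⟩, -⟩ := S.flucDiss_spec x u
  set y := S.flucDiss x u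
  have hmom : ∀ w : S.State, S.Mz⁻¹ *ᵥ w.1.pz = S.ν • ((S.gradξ w.1.q)ᵀ *ᵥ (S.M⁻¹ *ᵥ w.1.p)) := by
    intro w
    rw [show (S.gradξ w.1.q)ᵀ *ᵥ (S.M⁻¹ *ᵥ w.1.p) = S.ν⁻¹ • (S.Mz⁻¹ *ᵥ w.1.pz) from w.2.2,
      smul_smul, mul_inv_cancel₀ S.ν_pos.ne', one_smul]
  have hx2 := hmom x
  have hy2 := hmom y
  rw [hq] at hy2
  have ex := S.toPhase_snd x
  have ey := S.toPhase_snd y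
  rw [hq] at ey
  set v₁ := S.M⁻¹ *ᵥ x.1.p with hv₁
  set v₂ := S.M⁻¹ *ᵥ y.1.p with hv₂
  have fx : (S.toPhase x).2 = S.penMass x.1.q *ᵥ v₁ := rfl
  have fy : (S.toPhase y).2 = S.penMass x.1.q *ᵥ v₂ := by rw [← hq]; rfl
  have hν := S.ν_pos.ne'
  have key : S.midMass x.1.q *ᵥ v₂
      = (S.penMass x.1.q - (S.δt / 2) • S.penFriction x.1.q) *ᵥ v₁
      + Real.sqrt S.δt • (S.σ *ᵥ u.1 + S.ν • (S.gradξ x.1.q *ᵥ (S.σz *ᵥ u.2))) := by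
    rw [midMass, Matrix.add_mulVec, Matrix.sub_mulVec, ← fy, ← fx, ex, ey]
    nth_rewrite 1 [hp, hpz]
    simp only [penFriction, Matrix.smul_mulVec, Matrix.add_mulVec, Matrix.mulVec_add, ← hv₁, ← hv₂,
      hx2, hy2, Matrix.mulVec_smul, ← Matrix.mulVec_mulVec, Matrix.mulVec_sub]
    match_scalars <;> field_simp <;> ring
  have hinv : (S.penMass x.1.q)⁻¹ *ᵥ (S.toPhase x).2 = v₁ := by
    rw [fx, Matrix.mulVec_mulVec, Matrix.nonsing_inv_mul _ (S.isUnit_det_penMass _),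
      Matrix.one_mulVec]
  refine Prod.ext hq ?_
  rw [midUpdate, hinv, ← key, fy, ← Matrix.mulVec_mulVec, Matrix.mulVec_mulVec _ (S.midMass _)⁻¹,
    Matrix.nonsing_inv_mul _ (S.isUnit_det_midMass _), Matrix.one_mulVec]

theorem flucDiss_eq (x : S.State) (u : (Fin d → ℝ) × (Fin n → ℝ)) :
    S.flucDiss x u = S.ofPhase (x.1.q, S.midUpdate x.1.q (S.toPhase x).2 u) := by
  rw [← toPhase_flucDiss, ofPhase_toPhase]

theorem continuous_midUpdate :
    Continuous fun y : ((Fin d → ℝ) × (Fin d → ℝ)) × ((Fin d → ℝ) × (Fin n → ℝ)) =>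
      S.midUpdate y.1.1 y.1.2 y.2 := by
  have h1 := S.continuous_gradξ
  have h2 := S.continuous_penMass
  have h3 := S.continuous_penMass_inv
  have h4 : Continuous S.penFriction := by unfold penFriction; fun_prop
  have h5 : Continuous S.midMass := by unfold midMass; fun_prop
  have h6 : Continuous fun q => (S.midMass q)⁻¹ := by
    simp only [Matrix.inv_def, Ring.inverse_eq_inv']
    exact (h5.matrix_det.inv₀ fun q => (S.isUnit_det_midMass q).ne_zero).smul h5.matrix_adjugate
  have hq : Continuous fun y : ((Fin d → ℝ) × (Fin d → ℝ)) × ((Fin d → ℝ) × (Fin n → ℝ)) => y.1.1 :=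
    continuous_fst.comp continuous_fst
  have e1 := (h3.comp hq).matrix_mulVec (continuous_snd.comp continuous_fst)
  have e2 := ((h2.comp hq).sub ((h4.comp hq).const_smul (S.δt / 2))).matrix_mulVec e1
  have e3 := (continuous_const (y := S.σz)).matrix_mulVec
    (continuous_snd.comp (continuous_snd (X := (Fin d → ℝ) × (Fin d → ℝ))
      (Y := (Fin d → ℝ) × (Fin n → ℝ))))
  have e4 := ((h1.comp hq).matrix_mulVec e3).const_smul S.ν
  have e5 := (continuous_const (y := S.σ)).matrix_mulVec
    (continuous_fst.comp (continuous_snd (X := (Fin d → ℝ) × (Fin d → ℝ))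
      (Y := (Fin d → ℝ) × (Fin n → ℝ))))
  exact ((h2.comp hq).matrix_mul (h6.comp hq)).matrix_mulVec
    (e2.add ((e5.add e4).const_smul (Real.sqrt S.δt)))

theorem measurable_flucDiss :
    Measurable fun y : S.State × ((Fin d → ℝ) × (Fin n → ℝ)) => S.flucDiss y.1 y.2 := by
  simp only [flucDiss_eq]
  exact (S.continuous_ofPhase.comp
    ((continuous_fst.comp (S.continuous_toPhase.comp continuous_fst)).prodMk
      (S.continuous_midUpdate.comp
        ((S.continuous_toPhase.comp continuous_fst).prodMk continuous_snd)))).measurable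

theorem flucDiss_ofPhase (y : (Fin d → ℝ) × (Fin d → ℝ)) (u : (Fin d → ℝ) × (Fin n → ℝ)) :
    S.flucDiss (S.ofPhase y) u = S.ofPhase (y.1, S.midUpdate y.1 y.2 u) := by
  rw [flucDiss_eq, toPhase_ofPhase]
  rfl

/-- The mid-point scheme preserves the Gaussian distribution of `p_ν` at each position. -/
theorem lintegral_midUpdate (q : Fin d → ℝ) {L : Matrix (Fin d) (Fin d) ℝ}
    (hL : L * Lᵀ = S.β⁻¹ • S.penMass q) {f : (Fin d → ℝ) → ENNReal} (hf : Measurable f) :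
    ∫⁻ w, ∫⁻ u, f (S.midUpdate q (L *ᵥ w) u) ∂(stdGaussianPi d).prod (stdGaussianPi n)
        ∂stdGaussianPi d = ∫⁻ w, f (L *ᵥ w) ∂stdGaussianPi d := by
  set P := S.penMass q with hP
  set Γ := S.penFriction q with hΓ
  set D := S.midMass q with hD
  have hPu : IsUnit P.det := S.isUnit_det_penMass q
  have hDu : IsUnit D.det := S.isUnit_det_midMass q
  have hPt : Pᵀ = P := S.transpose_penMass q
  have hΓt : Γᵀ = Γ := S.transpose_penFriction q
  have hDt : Dᵀ = D := S.transpose_midMass q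
  have hPit : P⁻¹ᵀ = P⁻¹ := by rw [Matrix.transpose_nonsing_inv, hPt]
  have hDit : D⁻¹ᵀ = D⁻¹ := by rw [Matrix.transpose_nonsing_inv, hDt]
  have hβ := S.β_pos.ne'
  have hsq : Real.sqrt S.δt * Real.sqrt S.δt = S.δt := Real.mul_self_sqrt S.δt_pos.le
  set E := P - (S.δt / 2) • Γ with hE
  have hEt : Eᵀ = E := by rw [hE, Matrix.transpose_sub, Matrix.transpose_smul, hPt, hΓt]
  -- The fluctuation-dissipation identity passes to the penalized friction.
  have hnoise : S.σ * S.σᵀ + (S.ν • (S.gradξ q * S.σz)) * (S.ν • (S.gradξ q * S.σz))ᵀ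
      = (2 / S.β) • Γ := by
    rw [Matrix.transpose_smul, Matrix.smul_mul, Matrix.mul_smul, smul_smul, Matrix.transpose_mul,
      Matrix.mul_assoc, ← Matrix.mul_assoc S.σz, S.σz_mul_transpose, S.σ_mul_transpose, hΓ,
      penFriction, smul_add, Matrix.smul_mul, Matrix.mul_smul, Matrix.mul_assoc, ← pow_two,
      smul_comm]
  -- E and D are P ∓ (δt/2)Γ, so the terms of second order in δt agree and the cross terms differ by
  -- 2δtΓ. This exact identity is why the scheme has no bias in δt.
  have hquad : E * P⁻¹ * E + (2 * S.δt) • Γ = D * P⁻¹ * D := by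
    have h1 : P * P⁻¹ = 1 := Matrix.mul_nonsing_inv _ hPu
    have h2 : P⁻¹ * P = 1 := Matrix.nonsing_inv_mul _ hPu
    rw [hE, hD, midMass, ← hP, ← hΓ]
    simp only [Matrix.sub_mul, Matrix.add_mul, Matrix.mul_sub, Matrix.mul_add, Matrix.smul_mul,
      Matrix.mul_smul, h1, Matrix.one_mul, Matrix.mul_assoc, h2, Matrix.mul_one]
    module
  -- The covariance of the updated momentum, transported part plus two noise parts, equals the
  -- initial one.
  have hcov : (P * D⁻¹ * E * P⁻¹ * L) * (P * D⁻¹ * E * P⁻¹ * L)ᵀ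
      + (Real.sqrt S.δt • (P * D⁻¹ * S.σ)) * (Real.sqrt S.δt • (P * D⁻¹ * S.σ))ᵀ
      + (Real.sqrt S.δt • (P * D⁻¹ * (S.ν • (S.gradξ q * S.σz))))
        * (Real.sqrt S.δt • (P * D⁻¹ * (S.ν • (S.gradξ q * S.σz))))ᵀ = L * Lᵀ := by
    generalize S.ν • (S.gradξ q * S.σz) = G at hnoise ⊢
    have e1 : (P * D⁻¹ * E * P⁻¹ * L) * (P * D⁻¹ * E * P⁻¹ * L)ᵀ
        = S.β⁻¹ • (P * D⁻¹ * (E * P⁻¹ * E) * (D⁻¹ * P)) := by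
      simp only [Matrix.transpose_mul, hPt, hPit, hDit, hEt]
      have : P * D⁻¹ * E * P⁻¹ * L * (Lᵀ * (P⁻¹ * (E * (D⁻¹ * P))))
          = P * D⁻¹ * E * P⁻¹ * (L * Lᵀ) * (P⁻¹ * (E * (D⁻¹ * P))) := by
        simp only [Matrix.mul_assoc]
      rw [this, hL, Matrix.mul_smul, Matrix.smul_mul]
      congr 1
      rw [Matrix.mul_assoc _ P⁻¹ P, Matrix.nonsing_inv_mul _ hPu, Matrix.mul_one]
      simp only [Matrix.mul_assoc]
    have e2 : ∀ {k : ℕ} (G : Matrix (Fin d) (Fin k) ℝ),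
        (Real.sqrt S.δt • (P * D⁻¹ * G)) * (Real.sqrt S.δt • (P * D⁻¹ * G))ᵀ
          = S.δt • (P * D⁻¹ * (G * Gᵀ) * (D⁻¹ * P)) := by
      intro k G
      rw [Matrix.transpose_smul, Matrix.smul_mul, Matrix.mul_smul, smul_smul, hsq]
      simp only [Matrix.transpose_mul, hPt, hDit, Matrix.mul_assoc]
    rw [e1, e2, e2, add_assoc, ← smul_add, ← Matrix.add_mul, ← Matrix.mul_add, hnoise]
    have e3 : S.δt • (P * D⁻¹ * ((2 / S.β) • Γ) * (D⁻¹ * P))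
        = S.β⁻¹ • (P * D⁻¹ * ((2 * S.δt) • Γ) * (D⁻¹ * P)) := by
      simp only [Matrix.mul_smul, Matrix.smul_mul, smul_smul]
      congr 1
      field_simp
    rw [e3, ← smul_add, ← Matrix.add_mul, ← Matrix.mul_add, hquad, hL]
    congr 1
    have : P * D⁻¹ * (D * P⁻¹ * D) * (D⁻¹ * P) = P * (D⁻¹ * D) * P⁻¹ * (D * D⁻¹) * P := by
      simp only [Matrix.mul_assoc]
    rw [this, Matrix.nonsing_inv_mul _ hDu, Matrix.mul_nonsing_inv _ hDu, Matrix.mul_one,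
      Matrix.mul_one, Matrix.mul_nonsing_inv _ hPu, Matrix.one_mul]
  have hlin : ∀ w u, S.midUpdate q (L *ᵥ w) u = (P * D⁻¹ * E * P⁻¹ * L) *ᵥ w
      + (Real.sqrt S.δt • (P * D⁻¹ * S.σ)) *ᵥ u.1
      + (Real.sqrt S.δt • (P * D⁻¹ * (S.ν • (S.gradξ q * S.σz)))) *ᵥ u.2 := by
    intro w u
    simp only [midUpdate, ← hP, ← hΓ, ← hD, ← hE, ← Matrix.mulVec_mulVec, Matrix.smul_mulVec,
      Matrix.mulVec_add, Matrix.mulVec_smul, smul_add, add_assoc]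
  have hmeas : Measurable fun w : (Fin d → ℝ) × (Fin d → ℝ) × (Fin n → ℝ) =>
      (P * D⁻¹ * E * P⁻¹ * L) *ᵥ w.1 + (Real.sqrt S.δt • (P * D⁻¹ * S.σ)) *ᵥ w.2.1
      + (Real.sqrt S.δt • (P * D⁻¹ * (S.ν • (S.gradξ q * S.σz)))) *ᵥ w.2.2 :=
    Continuous.measurable (by fun_prop)
  have hmeas' : Measurable fun w : Fin d → ℝ => L *ᵥ w := Continuous.measurable (by fun_prop)
  simp only [hlin]
  rw [← lintegral_map hf hmeas', ← map_stdGaussianPi_eq_of_covariance L _ _ _ hcov,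
    lintegral_map hf hmeas]
  exact (lintegral_prod _ (hf.comp hmeas).aemeasurable).symm

theorem lintegral_gibbs_mul {g : (Fin d → ℝ) × (Fin d → ℝ) → ENNReal} (hg : Measurable g) :
    ∫⁻ y, S.gibbs y * g y = ∫⁻ q, ∫⁻ p, S.gibbs (q, p) * g (q, p) := by
  rw [Measure.volume_eq_prod]
  exact lintegral_prod _ (S.measurable_gibbs.mul hg).aemeasurable

/-- The fluctuation/dissipation step preserves the Gibbs measure. -/
theorem lintegral_gibbs_flucDiss {f : S.State → ENNReal} (hf : Measurable f) :
    ∫⁻ y, S.gibbs y *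
        ∫⁻ u, f (S.flucDiss (S.ofPhase y) u) ∂(stdGaussianPi d).prod (stdGaussianPi n)
      = ∫⁻ y, S.gibbs y * f (S.ofPhase y) := by
  have hm : Measurable fun y : (Fin d → ℝ) × (Fin d → ℝ) =>
      ∫⁻ u, f (S.flucDiss (S.ofPhase y) u) ∂(stdGaussianPi d).prod (stdGaussianPi n) :=
    Measurable.lintegral_prod_right' (f := fun z : ((Fin d → ℝ) × (Fin d → ℝ)) × _ =>
      f (S.flucDiss (S.ofPhase z.1) z.2)) (hf.comp (S.measurable_flucDiss.comp
        ((S.measurable_ofPhase.comp measurable_fst).prodMk measurable_snd)))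
  have hm' : Measurable fun y => f (S.ofPhase y) := hf.comp S.measurable_ofPhase
  rw [S.lintegral_gibbs_mul hm, S.lintegral_gibbs_mul hm']
  refine lintegral_congr fun q => ?_
  obtain ⟨L, hL⟩ := S.exists_sqrt_penMass q
  have h1 := S.lintegral_gibbs_fibre q hL (hm.comp (measurable_prodMk_left (x := q)))
  have h2 := S.lintegral_gibbs_fibre q hL (hm'.comp (measurable_prodMk_left (x := q)))
  simp only [Function.comp_apply, flucDiss_ofPhase] at h1 h2 ⊢
  rw [h1, h2, S.lintegral_midUpdate q hL (f := fun p => f (S.ofPhase (q, p)))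
    (hm'.comp measurable_prodMk_left)]

end ImmpData

/-! ### The Metropolis rule with momentum reversal. -/

theorem lintegral_Icc_ite {a : ℝ} (h0 : 0 ≤ a) (h1 : a ≤ 1) (A B : ENNReal) :
    ∫⁻ t in Set.Icc (0 : ℝ) 1, (if t ≤ a then A else B)
      = ENNReal.ofReal a * A + ENNReal.ofReal (1 - a) * B := by
  have hunion : Set.Icc (0 : ℝ) 1 = Set.Icc 0 a ∪ Set.Ioc a 1 := (Set.Icc_union_Ioc_eq_Icc h0 h1).symm
  have hdisj : Disjoint (Set.Icc (0 : ℝ) a) (Set.Ioc a 1) :=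
    Set.disjoint_left.2 fun t ht ht' => not_lt.2 ht.2 ht'.1
  rw [hunion, lintegral_union measurableSet_Ioc hdisj,
    setLIntegral_congr_fun (g := fun _ => A) measurableSet_Icc fun t ht => if_pos ht.2,
    setLIntegral_congr_fun (g := fun _ => B) measurableSet_Ioc fun t ht => if_neg (not_le.2 ht.1),
    setLIntegral_const, setLIntegral_const, Real.volume_Icc, Real.volume_Ioc, sub_zero, mul_comm A,
    mul_comm B]

/-- The Metropolis rule with a measure-preserving proposal `Ψ` that is reversible up to the
involution `R`, and reversal by `R` upon rejection, preserves the Gibbs measure. -/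
theorem lintegral_metropolis {X : Type*} [MeasurableSpace X] {m : Measure X} {Ψ R : X → X}
    {H : X → ℝ} (β : ℝ) (hΨ : MeasurePreserving Ψ m m) (hR : MeasurePreserving R m m)
    (hH : Measurable H) (hRR : ∀ x, R (R x) = x) (hΨR : ∀ x, Ψ (R (Ψ x)) = R x)
    (hHR : ∀ x, H (R x) = H x) {f : X → ENNReal} (hf : Measurable f) :
    ∫⁻ x, ENNReal.ofReal (Real.exp (-β * H x)) *
        (ENNReal.ofReal (min 1 (Real.exp (-β * (H (Ψ x) - H x)))) * f (Ψ x)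
          + ENNReal.ofReal (1 - min 1 (Real.exp (-β * (H (Ψ x) - H x)))) * f (R x)) ∂m
      = ∫⁻ x, ENNReal.ofReal (Real.exp (-β * H x)) * f x ∂m := by
  set e : X → ENNReal := fun x => ENNReal.ofReal (Real.exp (-β * H x)) with he
  set a : X → ℝ := fun x => min 1 (Real.exp (-β * (H (Ψ x) - H x))) with ha
  have hem : Measurable e := (Real.measurable_exp.comp (hH.const_mul _)).ennreal_ofReal
  have ham : Measurable a := measurable_const.min
    (Real.measurable_exp.comp (((hH.comp hΨ.measurable).sub hH).const_mul _))
  have ha0 : ∀ x, 0 ≤ a x := fun x => le_min zero_le_one (Real.exp_pos _).le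
  have ha1 : ∀ x, a x ≤ 1 := fun x => min_le_left _ _
  -- The accepted flux is symmetric in x and Ψ x.
  have hs : ∀ x, e x * ENNReal.ofReal (a x) = min (e x) (e (Ψ x)) := by
    intro x
    simp only [he, ha]
    rw [← ENNReal.ofReal_mul (Real.exp_pos _).le, mul_min_of_nonneg _ _ (Real.exp_pos _).le,
      ENNReal.ofReal_min, mul_one, ← Real.exp_add]
    congr 3
    ring
  have hsum : ∀ x, e x * ENNReal.ofReal (a x) + e x * ENNReal.ofReal (1 - a x) = e x := by
    intro x
    rw [← mul_add, ← ENNReal.ofReal_add (ha0 x) (sub_nonneg.2 (ha1 x)), add_sub_cancel,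
      ENNReal.ofReal_one, mul_one]
  have heR : ∀ x, e (R x) = e x := fun x => by simp only [he, hHR]
  have hsm : Measurable fun x => e x * ENNReal.ofReal (a x) := hem.mul ham.ennreal_ofReal
  have hsΨ : Measurable fun x => e x * ENNReal.ofReal (a x) * f (Ψ x) :=
    hsm.mul (hf.comp hΨ.measurable)
  have hsR : Measurable fun x => e x * ENNReal.ofReal (a x) * f (R x) :=
    hsm.mul (hf.comp hR.measurable)
  -- The substitution x ↦ R(Ψ x) preserves m and only exchanges the arguments of the minimum.
  -- Accepted moves thus contribute what R would with the same weight, so both branches together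
  -- integrate f ∘ R against the Gibbs weight.
  have hflip : ∫⁻ x, e x * ENNReal.ofReal (a x) * f (Ψ x) ∂m
      = ∫⁻ x, e x * ENNReal.ofReal (a x) * f (R x) ∂m := by
    rw [← (hR.comp hΨ).lintegral_comp hsR]
    refine lintegral_congr fun x => ?_
    simp only [Function.comp_apply]
    rw [hs, hs, hRR, hΨR, heR, heR, min_comm]
  calc ∫⁻ x, e x * (ENNReal.ofReal (a x) * f (Ψ x) + ENNReal.ofReal (1 - a x) * f (R x)) ∂m
      = ∫⁻ x, e x * ENNReal.ofReal (a x) * f (Ψ x) ∂m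
        + ∫⁻ x, e x * ENNReal.ofReal (1 - a x) * f (R x) ∂m := by
        rw [← lintegral_add_left hsΨ]
        exact lintegral_congr fun x => by rw [mul_add, mul_assoc, mul_assoc]
    _ = ∫⁻ x, e (R x) * f (R x) ∂m := by
        rw [hflip, ← lintegral_add_left hsR]
        exact lintegral_congr fun x => by rw [← add_mul, hsum, heR]
    _ = ∫⁻ x, e x * f x ∂m := hR.lintegral_comp (hem.mul hf)

/-! ### Measurability and invariance of one full step. -/

instance (d n : ℕ) : IsProbabilityMeasure (ImmpData.noiseLaw d n) := by
  have : IsProbabilityMeasure ((volume : Measure ℝ).restrict (Set.Icc (0 : ℝ) 1)) :=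
    ⟨by simp⟩
  unfold ImmpData.noiseLaw
  infer_instance

namespace ImmpData

variable {d n : ℕ} (S : ImmpData d n)

theorem measurable_hamiltonian : Measurable fun x : S.State => S.hamiltonian x := by
  simp only [hamiltonian_eq]
  exact S.continuous_penHamiltonian.measurable.comp S.measurable_toPhase

theorem measurable_hmcStep (h : S.RattleGlobal) :
    Measurable fun y : S.State × (ℝ × (Fin d → ℝ) × (Fin n → ℝ)) => hmcStep h y.1 y.2 := by
  have hΨ := S.measurable_rattleFlow h
  have hH := S.measurable_hamiltonian
  have ha : Measurable fun x : S.State =>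
      min 1 (Real.exp (-S.β * (S.hamiltonian (rattleFlow h x) - S.hamiltonian x))) :=
    measurable_const.min (Real.measurable_exp.comp (((hH.comp hΨ).sub hH).const_mul _))
  have hset : MeasurableSet {y : S.State × (ℝ × (Fin d → ℝ) × (Fin n → ℝ)) | y.2.1 ≤
      min 1 (Real.exp (-S.β * (S.hamiltonian (rattleFlow h y.1) - S.hamiltonian y.1)))} :=
    measurableSet_le (measurable_fst.comp measurable_snd) (ha.comp measurable_fst)
  exact S.measurable_flucDiss.comp ((Measurable.ite hset (hΨ.comp measurable_fst)
    (S.measurable_reverse.comp measurable_fst)).prodMk (measurable_snd.comp measurable_snd))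

theorem lintegral_hmcStep (h : S.RattleGlobal) {f : S.State → ENNReal} (hf : Measurable f)
    (x : S.State) :
    ∫⁻ w, f (hmcStep h x w) ∂noiseLaw d n
      = ENNReal.ofReal
          (min 1 (Real.exp (-S.β * (S.hamiltonian (rattleFlow h x) - S.hamiltonian x)))) *
          ∫⁻ u, f (S.flucDiss (rattleFlow h x) u) ∂(stdGaussianPi d).prod (stdGaussianPi n)
        + ENNReal.ofReal
          (1 - min 1 (Real.exp (-S.β * (S.hamiltonian (rattleFlow h x) - S.hamiltonian x)))) *
          ∫⁻ u, f (S.flucDiss (S.reverse x) u) ∂(stdGaussianPi d).prod (stdGaussianPi n) := by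
  have hm : Measurable fun w => f (hmcStep h x w) :=
    hf.comp ((S.measurable_hmcStep h).comp measurable_prodMk_left)
  rw [noiseLaw, lintegral_prod _ hm.aemeasurable,
    ← lintegral_Icc_ite (le_min zero_le_one (Real.exp_pos _).le) (min_le_left _ _)]
  refine lintegral_congr fun t => ?_
  simp only [hmcStep]
  split_ifs <;> rfl

theorem lintegral_gibbs_eq_stateVolume {f : S.State → ENNReal} (hf : Measurable f) :
    ∫⁻ y, S.gibbs y * f (S.ofPhase y)
      = ∫⁻ x, ENNReal.ofReal (Real.exp (-S.β * S.hamiltonian x)) * f x ∂S.stateVolume := by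
  rw [S.lintegral_stateVolume
    (f := fun x => ENNReal.ofReal (Real.exp (-S.β * S.hamiltonian x)) * f x)
    ((Real.measurable_exp.comp (S.measurable_hamiltonian.const_mul _)).ennreal_ofReal.mul hf)]
  simp only [hamiltonian_ofPhase]
  rfl

theorem lintegral_stateCanonical {f : S.State → ENNReal} (hf : Measurable f) :
    ∫⁻ x, f x ∂S.stateCanonical
      = (∫⁻ y, S.gibbs y)⁻¹ * ∫⁻ y, S.gibbs y * f (S.ofPhase y) := by
  rw [stateCanonical, lintegral_map hf S.measurable_ofPhase, penCanonical_eq,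
    lintegral_smul_measure, smul_eq_mul]
  exact congrArg _ (lintegral_withDensity_eq_lintegral_mul _ S.measurable_gibbs
    (hf.comp S.measurable_ofPhase))

/-- One step of the Hybrid Monte Carlo scheme preserves the canonical distribution. -/
theorem lintegral_hmcStep_stateCanonical (h : S.RattleGlobal) {f : S.State → ENNReal}
    (hf : Measurable f) :
    ∫⁻ x, ∫⁻ w, f (hmcStep h x w) ∂noiseLaw d n ∂S.stateCanonical
      = ∫⁻ x, f x ∂S.stateCanonical := by
  have hm : Measurable fun x => ∫⁻ w, f (hmcStep h x w) ∂noiseLaw d n :=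
    (hf.comp (S.measurable_hmcStep h)).lintegral_prod_right'
  have hg : Measurable fun x =>
      ∫⁻ u, f (S.flucDiss x u) ∂(stdGaussianPi d).prod (stdGaussianPi n) :=
    (hf.comp S.measurable_flucDiss).lintegral_prod_right'
  rw [S.lintegral_stateCanonical hm, S.lintegral_stateCanonical hf,
    S.lintegral_gibbs_eq_stateVolume hm]
  congr 1
  simp only [S.lintegral_hmcStep h hf]
  rw [lintegral_metropolis S.β (S.measurePreserving_rattleFlow h) S.measurePreserving_reverse
    S.measurable_hamiltonian S.reverse_reverse (S.rattleFlow_reverse_rattleFlow h)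
    S.hamiltonian_reverse hg, ← S.lintegral_gibbs_eq_stateVolume hg,
    S.lintegral_gibbs_flucDiss hf]

/-! ### The transition kernel and the Markov property. -/

/-- The transition kernel of the Hybrid Monte Carlo scheme. -/
noncomputable def hmcKernel (h : S.RattleGlobal) : Kernel S.State S.State :=
  Kernel.map (Kernel.id ×ₖ Kernel.const S.State (noiseLaw d n)) fun y => hmcStep h y.1 y.2

instance (h : S.RattleGlobal) : IsMarkovKernel (S.hmcKernel h) :=
  Kernel.IsMarkovKernel.map _ (S.measurable_hmcStep h)

theorem hmcKernel_apply (h : S.RattleGlobal) (x : S.State) :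
    S.hmcKernel h x = (noiseLaw d n).map (hmcStep h x) := by
  rw [hmcKernel, Kernel.map_apply _ (S.measurable_hmcStep h), Kernel.prod_apply, Kernel.id_apply,
    Kernel.const_apply, Measure.dirac_prod,
    Measure.map_map (S.measurable_hmcStep h) measurable_prodMk_left]
  rfl

theorem measurable_hmcStep_right (h : S.RattleGlobal) (x : S.State) : Measurable (hmcStep h x) :=
  (S.measurable_hmcStep h).comp measurable_prodMk_left

theorem invariant_hmcKernel (h : S.RattleGlobal) : (S.hmcKernel h).Invariant S.stateCanonical := by
  refine Measure.ext_of_lintegral _ fun f hf => ?_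
  rw [Measure.lintegral_bind (S.hmcKernel h).measurable.aemeasurable hf.aemeasurable,
    ← S.lintegral_hmcStep_stateCanonical h hf]
  refine lintegral_congr fun x => ?_
  rw [hmcKernel_apply, lintegral_map hf (S.measurable_hmcStep_right h x)]

/-- Joint law of a random history `Y` and of one step started from its image `g Y`, driven by an
independent noise. -/
theorem map_hmcStep_eq_compProd (h : S.RattleGlobal) {Ω E : Type*} [MeasurableSpace Ω]
    [MeasurableSpace E] {P : Measure Ω} [IsProbabilityMeasure P] {Y : Ω → E} (hY : Measurable Y)
    {g : E → S.State} (hg : Measurable g) {ζ : Ω → ℝ × (Fin d → ℝ) × (Fin n → ℝ)}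
    (hζ : Measurable ζ) (hlaw : P.map ζ = noiseLaw d n) (hind : IndepFun Y ζ P) :
    P.map (fun ω => (Y ω, hmcStep h (g (Y ω)) (ζ ω)))
      = (P.map Y) ⊗ₘ ((S.hmcKernel h).comap g hg) := by
  have hprod := (indepFun_iff_map_prod_eq_prod_map_map hY.aemeasurable hζ.aemeasurable).1 hind
  have := Measure.isProbabilityMeasure_map hY.aemeasurable (μ := P)
  have hF : Measurable fun z : E × (ℝ × (Fin d → ℝ) × (Fin n → ℝ)) =>
      (z.1, hmcStep h (g z.1) z.2) :=
    measurable_fst.prodMk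
      ((S.measurable_hmcStep h).comp ((hg.comp measurable_fst).prodMk measurable_snd))
  have h1 : P.map (fun ω => (Y ω, hmcStep h (g (Y ω)) (ζ ω)))
      = ((P.map Y).prod (noiseLaw d n)).map fun z => (z.1, hmcStep h (g z.1) z.2) := by
    rw [← hlaw, ← hprod, Measure.map_map hF (hY.prodMk hζ)]
    rfl
  rw [h1]
  refine Measure.ext_of_lintegral _ fun f hf => ?_
  rw [lintegral_map hf hF, Measure.lintegral_compProd hf]
  refine (lintegral_prod _ (hf.comp hF).aemeasurable).trans ?_
  refine lintegral_congr fun y => ?_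
  rw [Kernel.comap_apply, hmcKernel_apply]
  exact (lintegral_map (hf.comp measurable_prodMk_left) (S.measurable_hmcStep_right h (g y))).symm

variable {S} in
theorem IsHMCSequence.measurable {h : S.RattleGlobal} {Ω : Type*} [MeasurableSpace Ω]
    {P : Measure Ω} {X : ℕ → Ω → S.State} (hX : S.IsHMCSequence h P X) (k : ℕ) :
    Measurable (X k) := by
  obtain ⟨ζ, hζ, -, -, hstep⟩ := hX.exists_noise
  induction k with
  | zero => exact hX.measurable_zero
  | succ k ih =>
    rw [funext (hstep k)]
    exact (S.measurable_hmcStep h).comp (ih.prodMk (hζ k))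

-- The Markov property in joint-law form: the history is the random element Y, and the kernel sees
-- only its last coordinate.
variable {S} in
theorem IsHMCSequence.map_eq_compProd {h : S.RattleGlobal} {Ω : Type*} [MeasurableSpace Ω]
    {P : Measure Ω} [IsProbabilityMeasure P] {X : ℕ → Ω → S.State} (hX : S.IsHMCSequence h P X)
    (k : ℕ) :
    P.map (fun ω => ((fun j : Fin (k + 1) => X j ω), X (k + 1) ω))
      = P.map (fun ω (j : Fin (k + 1)) => X j ω) ⊗ₘ
        ((S.hmcKernel h).comap (fun y : Fin (k + 1) → S.State => y (Fin.last k))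
          (measurable_pi_apply _)) := by
  obtain ⟨ζ, hζ, hlaw, hind, hstep⟩ := hX.exists_noise
  have := S.map_hmcStep_eq_compProd h
    (measurable_pi_lambda _ fun j : Fin (k + 1) => hX.measurable j)
    (measurable_pi_apply (Fin.last k)) (hζ k) (hlaw k) (hind k)
  rw [← this]
  congr 1
  exact funext fun ω => Prod.ext rfl (hstep k ω)

variable {S} in
/-- The states of the scheme form a Markov chain. -/
theorem IsHMCSequence.condExp_ae_eq {h : S.RattleGlobal} {Ω : Type*} [MeasurableSpace Ω]
    {P : Measure Ω} [IsProbabilityMeasure P] {X : ℕ → Ω → S.State} (hX : S.IsHMCSequence h P X)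
    (k : ℕ) {A : Set S.State} (hA : MeasurableSet A) :
    P⟦X (k + 1) ⁻¹' A | MeasurableSpace.comap (fun ω (j : Fin (k + 1)) => X j ω) inferInstance⟧
      =ᵐ[P] fun ω => (S.hmcKernel h (X k ω)).real A := by
  have hY : Measurable fun ω (j : Fin (k + 1)) => X j ω :=
    measurable_pi_lambda _ fun j => hX.measurable j
  -- Disintegrations are almost everywhere unique, so the kernel is the conditional law of the next
  -- state given the history.
  have h1 := condDistrib_ae_eq_of_measure_eq_compProd_of_measurable hY (hX.measurable (k + 1))
    (hX.map_eq_compProd k)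
  have h2 := condDistrib_ae_eq_condExp (μ := P) hY (hX.measurable (k + 1)) hA
  filter_upwards [h2, ae_of_ae_map hY.aemeasurable h1] with ω e2 e1
  rw [← e2, e1]
  rfl

-- The second marginal of the joint law of X_k and X_{k+1} is the law of X_k pushed through the
-- kernel, so invariance propagates by induction.
variable {S} in
theorem IsHMCSequence.map_eq_stateCanonical {h : S.RattleGlobal} {Ω : Type*} [MeasurableSpace Ω]
    {P : Measure Ω} [IsProbabilityMeasure P] {X : ℕ → Ω → S.State} (hX : S.IsHMCSequence h P X)
    (h0 : P.map (X 0) = S.stateCanonical) (k : ℕ) : P.map (X k) = S.stateCanonical := by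
  induction k with
  | zero => exact h0
  | succ k ih =>
    obtain ⟨ζ, hζ, hlaw, hind, hstep⟩ := hX.exists_noise
    have hlast : IndepFun (X k) (ζ k) P :=
      (hind k).comp (measurable_pi_apply (Fin.last k)) measurable_id
    have hc := congrArg Measure.snd
      (S.map_hmcStep_eq_compProd h (hX.measurable k) measurable_id (hζ k) (hlaw k) hlast)
    rw [Measure.snd_map_prodMk (hX.measurable k), Measure.snd_compProd, ih] at hc
    rw [funext (hstep k)]
    exact hc.trans (S.invariant_hmcKernel h)

theorem map_toPhase_stateCanonical : S.stateCanonical.map S.toPhase = S.penCanonical := by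
  rw [stateCanonical, Measure.map_map S.measurable_toPhase S.measurable_ofPhase,
    show S.toPhase ∘ S.ofPhase = id from funext S.toPhase_ofPhase, Measure.map_id]

end ImmpData

theorem mainTheorem9 {d n : ℕ} (S : ImmpData d n)
    (hZ : Integrable (fun q : Fin d → ℝ => Real.exp (-S.β * S.V q)))
    (hglobal : S.RattleGlobal) :
    IsProbabilityMeasure S.penCanonical ∧
    S.penCanonical.map Prod.fst = positionCanonical S.β S.V ∧
    ∃ K : Kernel S.State S.State, IsMarkovKernel K ∧
      (∀ x, K x = (ImmpData.noiseLaw d n).map (ImmpData.hmcStep hglobal x)) ∧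
      S.stateCanonical.map S.toPhase = S.penCanonical ∧
      K.Invariant S.stateCanonical ∧
      ∀ {Ω : Type*} [MeasurableSpace Ω] (P : Measure Ω) [IsProbabilityMeasure P]
        (X : ℕ → Ω → S.State), S.IsHMCSequence hglobal P X →
        (∀ k, Measurable (X k)) ∧
        (∀ k (A : Set S.State), MeasurableSet A →
          P⟦X (k + 1) ⁻¹' A | MeasurableSpace.comap (fun ω (j : Fin (k + 1)) => X j ω) inferInstance⟧
            =ᵐ[P] fun ω => (K (X k ω)).real A) ∧
        (P.map (X 0) = S.stateCanonical → ∀ k,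
          P.map (fun ω => S.toPhase (X k ω)) = S.penCanonical ∧
          P.map (fun ω => (X k ω).1.q) = positionCanonical S.β S.V) := by
  refine ⟨ImmpData.isProbabilityMeasure_penCanonical hZ, S.map_fst_penCanonical,
    S.hmcKernel hglobal, inferInstance, S.hmcKernel_apply hglobal, S.map_toPhase_stateCanonical,
    S.invariant_hmcKernel hglobal, ?_⟩
  intro Ω _ P _ X hX
  refine ⟨hX.measurable, fun k A hA => hX.condExp_ae_eq k hA, fun h0 k => ?_⟩
  have hphase : P.map (fun ω => S.toPhase (X k ω)) = S.penCanonical := by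
    rw [← S.map_toPhase_stateCanonical, ← hX.map_eq_stateCanonical h0 k,
      Measure.map_map S.measurable_toPhase (hX.measurable k)]
    rfl
  refine ⟨hphase, ?_⟩
  rw [← S.map_fst_penCanonical, ← hphase]
  exact (Measure.map_map measurable_fst (S.measurable_toPhase.comp (hX.measurable k))).symm
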